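/- Let $N,M,D$ be finite non-empty sets, whose sizes are denoted by the same letters. Let $\mathrm{Con}=\{f_s\}_{s\in D}$ be a family of functions $f_s:N\to M$, with linear map $[\mathrm{Con}](P)=\frac1D\sum_{s\in D}F_s(P)$, where $F_s$ is the 0/1 matrix of $f_s$, and let $G$ be the bipartite graph with left vertices $N$, right vertices $M$, left degree $D$ and neighbour function $\Gamma(x,s)=f_s(x)$. Let $k,k'$ be real numbers such that $\gamma=N2^{-k}$ and $\gamma'=M2^{-k'}$ are integers. The game $(G;2^k,2^{k'})$: the referee draws $s\in D$, $\vec x\in N^{\gamma}$, $\vec y\in M^{\gamma'}$ uniformly and independently; Alice receives $\vec x$ and answers $\alpha\in\{1,\dots,\gamma\}$, Bob receives $\vec y$ and answers $\beta\in\{1,\dots,\gamma'\}$; they win if $\Gamma(x_\alpha,s)=y_\beta$. Let $\omega(G;2^k,2^{k'})$ be the maximal winning probability with deterministic strategies, $\omega^*_Q(G;2^k,2^{k'})$ the supremum of the winning probabilities when the players share a pure state in $\mathbb C^Q\otimes\mathbb C^Q$ and answer by (possibly incomplete) POVMs in $\mathrm{Mat}_Q$ indexed by their questions, and $\omega^*=\sup_Q\omega^*_Q$.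 Norms: on $\mathbb C^N$, $\|x\|_{\cap\{2^k\ell_\infty,\ell_1\}}=\max\{2^k\|x\|_\infty,\|x\|_1\}$; on $\mathbb C^M$, $\|y\|_{\Sigma\{2^{k'}\ell_\infty,\ell_1\}}=\inf\{2^{k'}\|y_1\|_\infty+\|y_2\|_1:y_1+y_2=y\}$. For $x\in\mathrm{Mat}_Q(\mathbb C^N)$, seen as a block-diagonal element of $\mathrm{Mat}_{QN}$, the operator space $\cap\cdot\cap\{2^k\ell_\infty,\ell_1\}$ has the norms $$\|x\|=\inf\Big\{\max\{2^{k/2}\|a\|,\|\Lambda(a)\|\}\cdot\max\{2^{k/2}\|b\|,\|\Lambda(b)\|\}:\ x=ab^*,\ a,b\in\mathrm{Mat}_{QN}\Big\},$$ where $\|\cdot\|$ on the right is the operator norm and $\Lambda(|i\rangle\langle j|\otimes|u\rangle\langle v|)=|i\rangle\langle j|\otimes\langle u|\otimes\langle v|$. The operator space $\Sigma\cdot\Sigma\{2^{k'}\ell_\infty,\ell_1\}$ is $2^{k'}$ times the operator space dual of $\cap\cdot\cap\{2^{k'}\ell_\infty,\ell_1\}$ on $\mathbb C^M$. Write $\|[\mathrm{Con}]\|_Q$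 for the norm of $1_Q\otimes[\mathrm{Con}]$ from $M_Q(\cap\cdot\cap\{2^k\ell_\infty,\ell_1\})$ to $M_Q(\Sigma\cdot\Sigma\{2^{k'}\ell_\infty,\ell_1\})$ (the quantity for $Q$-dimensional quantum side information), and $\|[\mathrm{Con}]\|_{\mathrm{cb}}=\sup_Q\|[\mathrm{Con}]\|_Q$. Theorem. There is a universal constant $c>0$ such that, for all such data, $$\omega(G;2^k,2^{k'})\le 2^{-k'}\big\|[\mathrm{Con}]:\cap\{2^k\ell_\infty,\ell_1\}\to\Sigma\{2^{k'}\ell_\infty,\ell_1\}\big\|\le c\,\omega(G;2^k,2^{k'}),$$ $$\omega^*(G;2^k,2^{k'})\le 2^{-k'}\big\|[\mathrm{Con}]:\cap\cdot\cap\{2^k\ell_\infty,\ell_1\}\to\Sigma\cdot\Sigma\{2^{k'}\ell_\infty,\ell_1\}\big\|_{\mathrm{cb}}\le c\,\omega^*(G;2^k,2^{k'}).$$ Furthermore, the local dimension of the entanglement corresponds to the dimension of the quantum side information: for every $Q\ge1$, $$\omega^*_Q(G;2^k,2^{k'})\le 2^{-k'}\|[\mathrm{Con}]\|_Q\le c\,\omega^*_Q(G;2^k,2^{k'}).$$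 -/

import Mathlib

open scoped ENNReal NNReal BigOperators Matrix Kronecker ComplexOrder

namespace Condenser

section OperatorNorm

open scoped Matrix.Norms.L2Operator

/-- The operator norm (largest singular value) of a complex matrix. -/
noncomputable def opNorm {m n : Type} [Fintype m] [Fintype n] [DecidableEq n]
    (A : Matrix m n ℂ) : ℝ := ‖A‖

end OperatorNorm

/-! ### The linear map of a condenser -/

/-- The `M × N` matrix of a function `g : N → M`: entry `(y, x)` is `1` if `g x = y`, else `0`. -/
def functionMatrix {N M : ℕ} (g : Fin N → Fin M) : Matrix (Fin M) (Fin N) ℂ :=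
  Matrix.of fun y x => if g x = y then 1 else 0

/-- The linear map `[Con](P) = (1/D) ∑ₛ Fₛ(P)` of a family `Con = (fₛ)ₛ`. -/
noncomputable def conMap {N M D : ℕ} (f : Fin D → Fin N → Fin M) :
    (Fin N → ℂ) →ₗ[ℂ] (Fin M → ℂ) :=
  Matrix.mulVecLin ((D : ℂ)⁻¹ • ∑ s, functionMatrix (f s))

/-- The neighbour function `Γ(x, s) = fₛ(x)` of the bipartite graph of a condenser, with left
vertices `N`, right vertices `M` and left degree `D`. -/
def neighbor {N M D : ℕ} (f : Fin D → Fin N → Fin M) : Fin N → Fin D → Fin M :=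
  fun x s => f s x

/-! ### Norms on `ℂ^N` (the norm `‖x‖` of a function on `Fin N` is the sup norm) -/

/-- `‖x‖_{∩{K ℓ∞, ℓ1}} = max {K ‖x‖_∞, ‖x‖_1}`. -/
noncomputable def capNorm {N : ℕ} (K : ℝ) (x : Fin N → ℂ) : ℝ :=
  max (K * ‖x‖) (∑ i, ‖x i‖)

/-- `‖y‖_{Σ{K ℓ∞, ℓ1}} = inf {K ‖y₁‖_∞ + ‖y₂‖_1 : y₁ + y₂ = y}`. -/
noncomputable def sigmaNorm {M : ℕ} (K : ℝ) (y : Fin M → ℂ) : ℝ≥0∞ :=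
  ⨅ (y₁ : Fin M → ℂ) (y₂ : Fin M → ℂ) (_ : y₁ + y₂ = y),
    ENNReal.ofReal (K * ‖y₁‖ + ∑ i, ‖y₂ i‖)

/-- The bounded norm `‖u : ∩{K ℓ∞, ℓ1} → Σ{K' ℓ∞, ℓ1}‖`. -/
noncomputable def boundedNorm {N M : ℕ} (K K' : ℝ)
    (u : (Fin N → ℂ) →ₗ[ℂ] (Fin M → ℂ)) : ℝ≥0∞ :=
  ⨆ (x : Fin N → ℂ) (_ : capNorm K x ≤ 1), sigmaNorm K' (u x)

/-! ### Matrix norms on `Mat_Q(ℂ^N)` and completely bounded norms -/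

/-- `Mat_Q(ℂ^N)`: the element `x = ∑ⱼ x(j) ⊗ |j⟩⟨j|` is given by its blocks `x(j) ∈ Mat_Q`. -/
abbrev MatOver (Q N : ℕ) : Type := Fin N → Matrix (Fin Q) (Fin Q) ℂ

/-- A sequence of (extended) norms on the spaces `Mat_Q(ℂ^N)`, `Q ∈ ℕ`. -/
abbrev MatNorms (N : ℕ) : Type := (Q : ℕ) → MatOver Q N → ℝ≥0∞

/-- The amplification `u_Q = 1_Q ⊗ u`, that is, `u` applied to every matrix entry. -/
def amplification {N M : ℕ} (u : (Fin N → ℂ) →ₗ[ℂ] (Fin M → ℂ)) {Q : ℕ}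
    (x : MatOver Q N) : MatOver Q M :=
  fun y => Matrix.of fun i j => u (fun l => x l i j) y

/-- The norm of `u_Q : M_Q(E) → M_Q(F)`. -/
noncomputable def amplifiedNorm {N M : ℕ} (E : MatNorms N) (F : MatNorms M) (Q : ℕ)
    (u : (Fin N → ℂ) →ₗ[ℂ] (Fin M → ℂ)) : ℝ≥0∞ :=
  ⨆ (x : MatOver Q N) (_ : E Q x ≤ 1), F Q (amplification u x)

/-- The completely bounded norm `‖u : E → F‖_cb = sup_Q ‖u_Q : M_Q(E) → M_Q(F)‖`. -/
noncomputable def cbNorm {N M : ℕ} (E : MatNorms N) (F : MatNorms M)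
    (u : (Fin N → ℂ) →ₗ[ℂ] (Fin M → ℂ)) : ℝ≥0∞ :=
  ⨆ Q : ℕ, amplifiedNorm E F Q u

/-- The operator space dual: `‖x‖_{M_Q(E*)} = ‖x : E → M_Q‖_cb`, where `x ∈ Mat_Q(ℂ^N)` is the
map `v ↦ ∑ⱼ v(j) x(j)`; its amplification of order `R` sends `z` to `∑ⱼ z(j) ⊗ x(j)`. -/
noncomputable def opDual {N : ℕ} (E : MatNorms N) : MatNorms N := fun Q x =>
  ⨆ (R : ℕ) (z : MatOver R N) (_ : E R z ≤ 1), ENNReal.ofReal (opNorm (∑ j, z j ⊗ₖ x j))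

/-- The reshuffling `|i⟩⟨j| ⊗ |k⟩⟨l| ↦ |i⟩⟨j| ⊗ ⟨k| ⊗ ⟨l|`. -/
def reshuffle {Q N : ℕ} (a : Matrix (Fin Q × Fin N) (Fin Q × Fin N) ℂ) :
    Matrix (Fin Q) (Fin Q × Fin N × Fin N) ℂ :=
  Matrix.of fun i t => a (i, t.2.1) (t.1, t.2.2)

/-- `max {√K ‖a‖_∞, ‖reshuffle a‖_∞}`. -/
noncomputable def factorNorm {Q N : ℕ} (K : ℝ)
    (a : Matrix (Fin Q × Fin N) (Fin Q × Fin N) ℂ) : ℝ :=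
  max (√K * opNorm a) (opNorm (reshuffle a))

/-- The operator space `∩·∩{K ℓ∞, ℓ1}`: the infimum over the factorizations `x = a b*` in
`Mat_{QN}` of the product of the two factor norms, `x` being seen as a block-diagonal matrix. -/
noncomputable def capCap (N : ℕ) (K : ℝ) : MatNorms N := fun _ x =>
  ⨅ (a) (b) (_ : a * bᴴ = Matrix.blockDiagonal x),
    ENNReal.ofReal (factorNorm K a * factorNorm K b)

/-- The operator space `Σ·Σ{K ℓ∞, ℓ1} = K · Σ·Σ{ℓ∞, K⁻¹ ℓ1}`, where `Σ·Σ{ℓ∞, K⁻¹ ℓ1}` is the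
operator space dual of `∩·∩{K ℓ∞, ℓ1}`. -/
noncomputable def sigmaSigma (N : ℕ) (K : ℝ) : MatNorms N := fun Q x =>
  ENNReal.ofReal K * opDual (capCap N K) Q x

/-! ### The two-player game

The referee draws a seed `s ∈ D` and vectors `x ∈ N^γ`, `y ∈ M^γ'`, all uniform and independent.
Alice gets `x`, Bob gets `y`, they answer `α` and `β`, and win if `Γ(x_α, s) = y_β`. -/

/-- `1` if `Γ(x, s) = y`, and `0` otherwise. -/
def edgeIndicator {N M D : ℕ} (G : Fin N → Fin D → Fin M) (x : Fin N) (s : Fin D)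
    (y : Fin M) : ℝ :=
  if G x s = y then 1 else 0

/-- The classical value: the supremum over deterministic strategies `a`, `b`. -/
noncomputable def classicalValue {N M D : ℕ} (G : Fin N → Fin D → Fin M) (γ γ' : ℕ) : ℝ≥0∞ :=
  ⨆ (a : (Fin γ → Fin N) → Fin γ) (b : (Fin γ' → Fin M) → Fin γ'),
    ENNReal.ofReal (𝔼 s : Fin D, 𝔼 x : Fin γ → Fin N, 𝔼 y : Fin γ' → Fin M,
      edgeIndicator G (x (a x)) s (y (b y)))

/-- A family of (possibly incomplete) POVMs in `Mat_Q`, one for each question in `X`, with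
outcomes in `A`. -/
def IsPOVMFamily {X A : Type} [Fintype A] {Q : ℕ} (p : A → X → Matrix (Fin Q) (Fin Q) ℂ) :
    Prop :=
  (∀ a x, (p a x).PosSemidef) ∧ ∀ x, (1 - ∑ a, p a x).PosSemidef

/-- The entangled value with local dimension `Q`: the supremum over unit vectors
`ψ ∈ ℂ^Q ⊗ ℂ^Q` and pairs of POVM families. -/
noncomputable def entangledValueDim {N M D : ℕ} (G : Fin N → Fin D → Fin M) (γ γ' Q : ℕ) :
    ℝ≥0∞ :=
  ⨆ (ψ : Fin Q × Fin Q → ℂ) (_ : star ψ ⬝ᵥ ψ = 1)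
    (p : Fin γ → (Fin γ → Fin N) → Matrix (Fin Q) (Fin Q) ℂ) (_ : IsPOVMFamily p)
    (q : Fin γ' → (Fin γ' → Fin M) → Matrix (Fin Q) (Fin Q) ℂ) (_ : IsPOVMFamily q),
    ENNReal.ofReal (𝔼 s : Fin D, 𝔼 x : Fin γ → Fin N, 𝔼 y : Fin γ' → Fin M,
      ∑ α, ∑ β, edgeIndicator G (x α) s (y β) *
        (star ψ ⬝ᵥ ((p α x ⊗ₖ q β y) *ᵥ ψ)).re)

/-- The entangled value: the supremum over all local dimensions. -/
noncomputable def entangledValue {N M D : ℕ} (G : Fin N → Fin D → Fin M) (γ γ' : ℕ) : ℝ≥0∞ :=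
  ⨆ Q : ℕ, entangledValueDim G γ γ' Q

end Condenser

/-!
Averaging a strategy over its questions gives a positive element of the unit ball of
`∩{K ℓ∞, ℓ1}`, with coefficients in `Mat_Q` for entangled players and in `ℂ` for classical ones,
and the winning probability is a bilinear expression in the two elements which the players obtain
in this way. Hence the value of the game is at most the norm of `[Con]`.

Conversely, let `a` be a positive element of that unit ball. On the question `x` Alice measures the
effects `(K / 4) a(x 0), (K / 4) a(x 1), …` one after the other and answers the place of the first
one that occurs. The effects are so small that even the last of them is reached with substantial
probability, and therefore the average of this strategy dominates a multiple of `a` up to an error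
term, which is itself in the unit ball. If `a` is nearly optimal for Bob's strategy, then the error
term cannot cost more than a constant factor. So positive elements of the unit balls can be replaced
by strategies. Arbitrary elements are reduced to positive ones by the Cauchy–Schwarz inequality,
applied to the factorizations `x = a b*`.
-/

namespace Condenser

section ProductExpectation

variable {ι M : Type*} [Fintype ι] [AddCommMonoid M] [Module ℚ≥0 M]

theorem expect_fin_succ_pi {n : ℕ} (F : (Fin (n + 1) → ι) → M) :
    𝔼 x, F x = 𝔼 w, 𝔼 x : Fin n → ι, F (Fin.cons w x) := by
  rw [← Finset.expect_product' Finset.univ Finset.univ fun w x => F (Fin.cons w x),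
    Finset.univ_product_univ]
  exact (Fintype.expect_equiv (Fin.consEquiv fun _ => ι) _ _ fun _ => rfl).symm

theorem expect_eval (F : ι → M) : ∀ {n : ℕ} (α : Fin n), 𝔼 x : Fin n → ι, F (x α) = 𝔼 u, F u
  | 0, α => α.elim0
  | n + 1, α => by
    cases isEmpty_or_nonempty ι
    · simp
    rw [expect_fin_succ_pi]
    induction α using Fin.cases with
    | zero => simp
    | succ j => simp [expect_eval F j]

theorem expect_ite_eval [DecidableEq ι] (a : M) (u : ι) {n : ℕ} (α : Fin n) :
    𝔼 x : Fin n → ι, (if x α = u then a else 0) = (Fintype.card ι : ℚ≥0)⁻¹ • a := by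
  rw [expect_eval fun v => if v = u then a else 0, Finset.expect]
  simp

theorem expect_ite_partialProd [DecidableEq ι] {R : Type*} [Ring R] [Module ℚ≥0 R] (E : ι → R)
    (u : ι) : ∀ {n : ℕ} (α : Fin n),
      𝔼 x : Fin n → ι, (if x α = u then Fin.partialProd (E ∘ x) α.castSucc else 0) =
        (Fintype.card ι : ℚ≥0)⁻¹ • (𝔼 v, E v) ^ (α : ℕ)
  | 0, α => α.elim0
  | n + 1, α => by
    rw [expect_fin_succ_pi]
    induction α using Fin.cases with
    | zero =>
      have : Nonempty ι := ⟨u⟩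
      simp
    | succ j =>
      have tail (w : ι) (x : Fin n → ι) :
          Fin.partialProd (E ∘ Fin.cons w x) j.succ.castSucc =
            E w * Fin.partialProd (E ∘ x) j.castSucc := by
        rw [← Fin.succ_castSucc, Fin.partialProd_succ']
        rfl
      simp only [Fin.cons_succ, tail, ← mul_ite_zero, ← Finset.mul_expect,
        expect_ite_partialProd E u j, ← Finset.expect_mul]
      rw [mul_smul_comm, Fin.val_succ, pow_succ']

theorem star_expect {A : Type*} [AddCommGroup A] [StarAddMonoid A] [Module ℚ≥0 A] (F : ι → A) :
    star (𝔼 i, F i) = 𝔼 i, star (F i) := by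
  simp [Finset.expect]

theorem expect_le_of_nonneg [PartialOrder M] [IsOrderedAddMonoid M] [PosSMulMono ℚ≥0 M]
    {F : ι → M} {b : M} (hb : 0 ≤ b) (hF : ∀ i, F i ≤ b) : 𝔼 i, F i ≤ b := by
  cases isEmpty_or_nonempty ι
  · simpa using hb
  · exact Finset.expect_le Finset.univ_nonempty fun i _ => hF i

end ProductExpectation

section BoundedFamily

variable {A : Type*} [CStarAlgebra A] {ι : Type*}

theorem norm_one_sub_pow_le {m : A} (hm : ‖m‖ ≤ 1) (j : ℕ) : ‖1 - m ^ j‖ ≤ j * ‖1 - m‖ := by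
  induction j with
  | zero => simp
  | succ j ih =>
    calc ‖1 - m ^ (j + 1)‖ = ‖(1 - m ^ j) * m + (1 - m)‖ := by rw [pow_succ]; congr 1; noncomm_ring
      _ ≤ ‖1 - m ^ j‖ * ‖m‖ + ‖1 - m‖ := (norm_add_le _ _).trans (by gcongr; exact norm_mul_le _ _)
      _ ≤ ‖1 - m ^ j‖ * 1 + ‖1 - m‖ := by gcongr
      _ ≤ j * ‖1 - m‖ * 1 + ‖1 - m‖ := by gcongr
      _ = (j + 1 : ℕ) * ‖1 - m‖ := by push_cast; ring

variable [PartialOrder A] [StarOrderedRing A] [Fintype ι]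

/-- The positive part of the unit ball of `∩{K ℓ∞, ℓ1}` with coefficients in a C⋆-algebra. -/
structure IsBoundedFamily (K : ℝ) (a : ι → A) : Prop where
  nonneg : ∀ u, 0 ≤ a u
  smul_le_one : ∀ u, K • a u ≤ 1
  sum_le_one : ∑ u, a u ≤ 1

/-- A strategy of one player, who answers the question `ω` by `o` with effect `P o ω`; the effects
may sum up to less than `1`. -/
structure IsStrategy {O Ω : Type*} [Fintype O] (P : O → Ω → A) : Prop where
  nonneg : ∀ o ω, 0 ≤ P o ω
  sum_le_one : ∀ ω, ∑ o, P o ω ≤ 1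

namespace IsBoundedFamily

variable {K : ℝ} {a : ι → A}

theorem zero : IsBoundedFamily K (0 : ι → A) where
  nonneg _ := le_rfl
  smul_le_one _ := by simp
  sum_le_one := by simp

theorem conj (ha : IsBoundedFamily K a) {h : A} (hh : star h * h ≤ 1) :
    IsBoundedFamily K fun u => star h * a u * h where
  nonneg u := star_left_conjugate_nonneg (ha.nonneg u) h
  smul_le_one u := by
    have := star_left_conjugate_le_conjugate (ha.smul_le_one u) h
    rw [mul_one, mul_smul_comm, smul_mul_assoc] at this
    exact this.trans hh
  sum_le_one := by
    have := star_left_conjugate_le_conjugate ha.sum_le_one h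
    rw [mul_one, Finset.mul_sum, Finset.sum_mul] at this
    exact this.trans hh

theorem expect [Module ℚ≥0 A] {κ : Type*} [Fintype κ] {a : κ → ι → A}
    (ha : ∀ i, IsBoundedFamily K (a i)) : IsBoundedFamily K fun u => 𝔼 i, a i u := by
  refine ⟨fun u => Finset.expect_nonneg fun i _ => (ha i).nonneg u, fun u => ?_, ?_⟩
  · rw [Finset.smul_expect]
    exact expect_le_of_nonneg zero_le_one fun i => (ha i).smul_le_one u
  · rw [← Finset.expect_sum_comm]
    exact expect_le_of_nonneg zero_le_one fun i => (ha i).sum_le_one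

theorem norm_expect_le [Module ℚ≥0 A] (ha : IsBoundedFamily K a) :
    ‖𝔼 u, a u‖ ≤ (Fintype.card ι : ℝ)⁻¹ := by
  have hsum : ‖∑ u, a u‖ ≤ 1 :=
    (CStarAlgebra.norm_le_one_iff_of_nonneg _ (Finset.sum_nonneg fun u _ => ha.nonneg u)).2
      ha.sum_le_one
  rw [Finset.expect, ← NNRat.cast_smul_eq_nnqsmul ℝ, norm_smul]
  simpa using mul_le_of_le_one_right (by positivity) hsum

end IsBoundedFamily

end BoundedFamily

section Marginal

variable {A : Type*} {ι : Type*} [Fintype ι] [DecidableEq ι]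

/-- The marginal of a strategy `P` whose questions are uniform tuples `x` and whose answers name
one of the entries of `x`: its value at `u` is the average of the effects of the answers `α` with
`x α = u`. -/
noncomputable def marginal [AddCommMonoid A] [Module ℚ≥0 A] {n : ℕ}
    (P : Fin n → (Fin n → ι) → A) : ι → A :=
  𝔼 x : Fin n → ι, ∑ α, Pi.single (x α) (P α x)

theorem marginal_apply [AddCommMonoid A] [Module ℚ≥0 A] {n : ℕ} (P : Fin n → (Fin n → ι) → A)
    (u : ι) : marginal P u = 𝔼 x : Fin n → ι, ∑ α, if x α = u then P α x else 0 := by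
  simp only [marginal, Finset.expect, Pi.smul_apply, Finset.sum_apply, Pi.single_apply, eq_comm]

theorem map_marginal [AddCommGroup A] [Module ℝ A] [Module ℚ≥0 A] {n : ℕ}
    (Φ : (ι → A) →ₗ[ℝ] ℝ) (P : Fin n → (Fin n → ι) → A) :
    Φ (marginal P) = 𝔼 x : Fin n → ι, ∑ α, Φ (Pi.single (x α) (P α x)) := by
  rw [marginal, ← LinearMap.coe_restrictScalars ℚ≥0 Φ, map_expect]
  simp only [map_sum]

variable [CStarAlgebra A] [PartialOrder A] [StarOrderedRing A] [Module ℚ≥0 A]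

theorem IsStrategy.isBoundedFamily_marginal {n : ℕ} {K : ℝ}
    (hn : (n : ℝ) * K = Fintype.card ι) {P : Fin n → (Fin n → ι) → A} (hP : IsStrategy P) :
    IsBoundedFamily K (marginal P) := by
  refine ⟨fun u => ?_, fun u => ?_, ?_⟩
  · rw [marginal_apply]
    refine Finset.expect_nonneg fun x _ => Finset.sum_nonneg fun α _ => ?_
    split_ifs
    exacts [hP.nonneg α x, le_rfl]
  · have hcard : (0 : ℝ) < Fintype.card ι := by
      exact_mod_cast Fintype.card_pos_iff.2 ⟨u⟩
    have hK : 0 < K := pos_of_mul_pos_right (hn ▸ hcard) n.cast_nonneg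
    have hle (α x) : P α x ≤ 1 :=
      (Finset.single_le_sum (fun β _ => hP.nonneg β x) (Finset.mem_univ α)).trans
        (hP.sum_le_one x)
    calc K • marginal P u
        ≤ K • 𝔼 x : Fin n → ι, ∑ α, if x α = u then 1 else 0 := by
          rw [marginal_apply]
          gcongr with x _ α
          split_ifs
          exacts [hle α x, le_rfl]
      _ = ((n : ℝ) * K / Fintype.card ι) • 1 := by
          simp only [Finset.expect_sum_comm, expect_ite_eval, Finset.sum_const,
            Finset.card_univ, Fintype.card_fin, ← NNRat.cast_smul_eq_nnqsmul ℝ,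
            ← Nat.cast_smul_eq_nsmul ℝ, smul_smul]
          congr 1
          push_cast
          ring
      _ = 1 := by rw [hn, div_self hcard.ne', one_smul]
  · simp only [marginal_apply]
    rw [← Finset.expect_sum_comm]
    refine expect_le_of_nonneg zero_le_one fun x => ?_
    rw [Finset.sum_comm]
    simpa using hP.sum_le_one x

end Marginal

section SequentialMeasurement

variable {A : Type*} [CStarAlgebra A]

/-- The effect of the outcome `α` when the effects `e 0, e 1, …` are measured one after the other
until one of them occurs. -/
def seqMeas {n : ℕ} (e : Fin n → A) (α : Fin n) : A :=
  Fin.partialProd (fun i => 1 - e i) α.castSucc * e α *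
    star (Fin.partialProd (fun i => 1 - e i) α.castSucc)

theorem seqMeas_succ {n : ℕ} (e : Fin (n + 1) → A) (α : Fin n) :
    seqMeas e α.succ = (1 - e 0) * seqMeas (Fin.tail e) α * star (1 - e 0) := by
  simp only [seqMeas, ← Fin.succ_castSucc, Fin.partialProd_succ', star_mul, mul_assoc]
  rfl

variable [PartialOrder A] [StarOrderedRing A]

theorem mul_one_sub_nonneg {e : A} (h0 : 0 ≤ e) (h1 : e ≤ 1) : 0 ≤ e * (1 - e) := by
  have h := add_nonneg (star_right_conjugate_nonneg (sub_nonneg.2 h1) e)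
    (star_right_conjugate_nonneg h0 (1 - e))
  rw [star_sub, star_one, h0.star_eq] at h
  convert h using 1
  noncomm_ring

theorem seqMeas_nonneg {n : ℕ} {e : Fin n → A} (he : ∀ i, 0 ≤ e i) (α : Fin n) :
    0 ≤ seqMeas e α :=
  star_right_conjugate_nonneg (he α) _

theorem sum_seqMeas_le_one : ∀ {n : ℕ} {e : Fin n → A}, (∀ i, 0 ≤ e i) → (∀ i, e i ≤ 1) →
    ∑ α, seqMeas e α ≤ 1
  | 0, _, _, _ => by simp
  | n + 1, e, h0, h1 => by
    have tail : ∑ α, seqMeas (Fin.tail e) α ≤ 1 :=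
      sum_seqMeas_le_one (fun i => h0 i.succ) fun i => h1 i.succ
    have hstar : star (1 - e 0) = 1 - e 0 := by rw [star_sub, star_one, (h0 0).star_eq]
    calc ∑ α, seqMeas e α
        = e 0 + (1 - e 0) * (∑ α, seqMeas (Fin.tail e) α) * star (1 - e 0) := by
          simp only [Fin.sum_univ_succ, seqMeas_succ, Finset.mul_sum, Finset.sum_mul]
          simp [seqMeas]
      _ ≤ e 0 + (1 - e 0) * 1 * star (1 - e 0) := by
          gcongr
          exact star_right_conjugate_le_conjugate tail _
      _ = 1 - e 0 * (1 - e 0) := by rw [hstar]; noncomm_ring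
      _ ≤ 1 := sub_le_self _ (mul_one_sub_nonneg (h0 0) (h1 0))

theorem IsStrategy.seqMeas {ι : Type*} {E : ι → A} (h0 : ∀ u, 0 ≤ E u) (h1 : ∀ u, E u ≤ 1)
    (n : ℕ) : IsStrategy fun (α : Fin n) (x : Fin n → ι) => seqMeas (E ∘ x) α where
  nonneg α x := seqMeas_nonneg (fun i => h0 (x i)) α
  sum_le_one x := sum_seqMeas_le_one (fun i => h0 (x i)) fun i => h1 (x i)

theorem mul_add_mul_star_le {a : A} (ha : 0 ≤ a) (S : A) :
    S * a + a * star S ≤ a + S * a * star S := by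
  have h := star_right_conjugate_nonneg ha (1 - S)
  rw [← sub_nonneg]
  convert h using 1
  rw [star_sub, star_one]
  noncomm_ring

variable [Module ℚ≥0 A] {ι : Type*} [Fintype ι]

/-- The effects are so small that even after `n` rounds the measurement has probably not
stopped. -/
theorem exists_expect_pow_eq [Nonempty ι] {K : ℝ} (hK : 0 < K) {n : ℕ}
    (hn : (n : ℝ) * K = Fintype.card ι) {a : ι → A} (ha : IsBoundedFamily K a) (α : Fin n) :
    ∃ h : A, IsSelfAdjoint h ∧ star h * h ≤ 1 ∧
      (𝔼 v, (1 - (K / 4) • a v)) ^ (α : ℕ) = 1 - (4⁻¹ : ℝ) • h := by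
  set m : A := 𝔼 v, (1 - (K / 4) • a v) with hm
  have h1m : 1 - m = (K / 4) • 𝔼 v, a v := by
    rw [hm, Finset.expect_sub_distrib, Fintype.expect_one, sub_sub_cancel, Finset.smul_expect]
  have hm0 : 0 ≤ m := Finset.expect_nonneg fun v _ => by
    rw [sub_nonneg]
    refine le_trans ?_ (ha.smul_le_one v)
    gcongr
    exacts [ha.nonneg v, by linarith]
  have hm1 : ‖m‖ ≤ 1 := by
    rw [CStarAlgebra.norm_le_one_iff_of_nonneg _ hm0, ← sub_nonneg, h1m]
    exact smul_nonneg (by positivity) (Finset.expect_nonneg fun v _ => ha.nonneg v)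
  have hnorm : ‖(4 : ℝ) • (1 - m ^ (α : ℕ))‖ ≤ 1 := by
    have hcard : (0 : ℝ) < Fintype.card ι := by exact_mod_cast Fintype.card_pos
    calc ‖(4 : ℝ) • (1 - m ^ (α : ℕ))‖ ≤ 4 * (α * ‖1 - m‖) := by
          rw [norm_smul, Real.norm_of_nonneg (by norm_num)]
          gcongr
          exact norm_one_sub_pow_le hm1 α
      _ ≤ 4 * (n * (K / 4 * (Fintype.card ι : ℝ)⁻¹)) := by
          rw [h1m, norm_smul, Real.norm_of_nonneg (by positivity)]
          gcongr
          exacts [α.2.le, ha.norm_expect_le]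
      _ = n * K * (Fintype.card ι : ℝ)⁻¹ := by ring
      _ = 1 := by rw [hn, mul_inv_cancel₀ hcard.ne']
  refine ⟨(4 : ℝ) • (1 - m ^ (α : ℕ)), ?_, ?_, by module⟩
  · exact .smul (.all _) (.sub (.one A) (hm0.isSelfAdjoint.pow _))
  · rw [← CStarAlgebra.norm_le_one_iff_of_nonneg _ (star_mul_self_nonneg _),
      CStarRing.norm_star_mul_self]
    exact mul_le_one₀ hnorm (norm_nonneg _) hnorm

variable [DecidableEq ι]

/-- The entries before the place `α` are independent of the entry at `α`, so that their factors
average to a power of `𝔼 v, (1 - E v)`. -/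
theorem le_expect_ite_seqMeas {E : ι → A} (hE : ∀ v, 0 ≤ E v) {n : ℕ} (α : Fin n) (u : ι)
    {S' : A} (hS' : (𝔼 v, (1 - E v)) ^ (α : ℕ) = S') :
    (Fintype.card ι : ℝ)⁻¹ • (S' * E u + E u * star S' - E u) ≤
      𝔼 x : Fin n → ι, if x α = u then seqMeas (E ∘ x) α else 0 := by
  let S (x : Fin n → ι) : A := Fin.partialProd ((fun v => 1 - E v) ∘ x) α.castSucc
  let T (x : Fin n → ι) : A := if x α = u then S x else 0
  have hT : 𝔼 x, T x = (Fintype.card ι : ℝ)⁻¹ • S' := by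
    rw [expect_ite_partialProd, hS', ← NNRat.cast_smul_eq_nnqsmul ℝ]
    simp
  have hE' : 𝔼 x : Fin n → ι, (if x α = u then E u else 0) = (Fintype.card ι : ℝ)⁻¹ • E u := by
    rw [expect_ite_eval, ← NNRat.cast_smul_eq_nnqsmul ℝ]
    simp
  calc (Fintype.card ι : ℝ)⁻¹ • (S' * E u + E u * star S' - E u)
      = (𝔼 x, T x) * E u + E u * star (𝔼 x, T x) -
          𝔼 x : Fin n → ι, (if x α = u then E u else 0) := by
        rw [hT, hE', star_smul, star_trivial (_ : ℝ), smul_mul_assoc, mul_smul_comm, smul_sub,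
          smul_add]
    _ = 𝔼 x : Fin n → ι, (T x * E u + E u * star (T x) - if x α = u then E u else 0) := by
        rw [star_expect, Finset.expect_mul, Finset.mul_expect, ← Finset.expect_add_distrib,
          ← Finset.expect_sub_distrib]
    _ ≤ 𝔼 x : Fin n → ι, if x α = u then seqMeas (E ∘ x) α else 0 := by
        refine Finset.expect_le_expect fun x _ => ?_
        by_cases hx : x α = u
        · subst hx
          simp only [T, if_true]
          rw [sub_le_iff_le_add']
          exact mul_add_mul_star_le (hE (x α)) (S x)
        · simp [T, hx]

theorem smul_sub_conj_le_expect_ite_seqMeas {K : ℝ} (hK : 0 ≤ K) {a : ι → A} (ha : ∀ v, 0 ≤ a v)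
    {h : A} (hh : IsSelfAdjoint h) {n : ℕ} {α : Fin n} (u : ι)
    (hpow : (𝔼 v, (1 - (K / 4) • a v)) ^ (α : ℕ) = 1 - (4⁻¹ : ℝ) • h) :
    (K / (16 * Fintype.card ι)) • ((3 : ℝ) • a u - star h * a u * h) ≤
      𝔼 x : Fin n → ι, if x α = u then seqMeas ((fun v => (K / 4) • a v) ∘ x) α else 0 := by
  have hE0 (v) : 0 ≤ (K / 4) • a v := smul_nonneg (by positivity) (ha v)
  have key := mul_add_mul_star_le (ha u) h
  rw [hh.star_eq] at key
  calc (K / (16 * Fintype.card ι)) • ((3 : ℝ) • a u - star h * a u * h)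
      = ((Fintype.card ι : ℝ)⁻¹ * (K / 16)) • ((4 : ℝ) • a u - (a u + h * a u * h)) := by
        rw [hh.star_eq]
        congr 1
        · field_simp
        · module
    _ ≤ ((Fintype.card ι : ℝ)⁻¹ * (K / 16)) • ((4 : ℝ) • a u - (h * a u + a u * h)) := by
        gcongr
    _ = (Fintype.card ι : ℝ)⁻¹ • ((1 - (4⁻¹ : ℝ) • h) * ((K / 4) • a u) +
          (K / 4) • a u * star (1 - (4⁻¹ : ℝ) • h) - (K / 4) • a u) := by
        simp only [star_sub, star_one, star_smul, star_trivial (_ : ℝ), hh.star_eq, sub_mul,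
          mul_sub, one_mul, mul_one, smul_mul_assoc, mul_smul_comm]
        module
    _ ≤ _ := le_expect_ite_seqMeas hE0 α u hpow

theorem exists_isStrategy_smul_le_marginal {K : ℝ} {n : ℕ} (hn : (n : ℝ) * K = Fintype.card ι)
    {a : ι → A} (ha : IsBoundedFamily K a) :
    ∃ P : Fin n → (Fin n → ι) → A, IsStrategy P ∧ ∃ a', IsBoundedFamily K a' ∧
      ∀ u, (3 : ℝ) • a u ≤ (16 : ℝ) • marginal P u + a' u := by
  rcases isEmpty_or_nonempty ι with _ | _
  · exact ⟨fun α x => seqMeas (a ∘ x) α, .seqMeas isEmptyElim isEmptyElim n, 0, .zero,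
      isEmptyElim⟩
  have hcard : (0 : ℝ) < Fintype.card ι := by exact_mod_cast Fintype.card_pos
  have hK : 0 < K := pos_of_mul_pos_right (hn ▸ hcard) n.cast_nonneg
  set E : ι → A := fun u => (K / 4) • a u
  have hE0 (u) : 0 ≤ E u := smul_nonneg (by positivity) (ha.nonneg u)
  have hE1 (u) : E u ≤ 1 := by
    refine le_trans ?_ (ha.smul_le_one u)
    exact smul_le_smul_of_nonneg_right (by linarith) (ha.nonneg u)
  choose h hsa hle hpow using exists_expect_pow_eq hK hn ha
  refine ⟨_, .seqMeas hE0 hE1 n, _, .expect fun α => ha.conj (hle α), fun u => ?_⟩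
  have : NeZero n := ⟨by rintro rfl; rw [Nat.cast_zero, zero_mul] at hn; exact hcard.ne hn⟩
  rw [← sub_le_iff_le_add]
  calc (3 : ℝ) • a u - 𝔼 α, star (h α) * a u * h α
      = 𝔼 α, ((3 : ℝ) • a u - star (h α) * a u * h α) := by
        rw [Finset.expect_sub_distrib, Fintype.expect_const]
    _ = (16 : ℝ) • ∑ α, (K / (16 * Fintype.card ι)) •
          ((3 : ℝ) • a u - star (h α) * a u * h α) := by
        rw [← Finset.smul_sum, smul_smul, Finset.expect, ← NNRat.cast_smul_eq_nnqsmul ℝ, ← hn]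
        congr 1
        simp
        field_simp
    _ ≤ (16 : ℝ) • marginal (fun α x => seqMeas (E ∘ x) α) u := by
        rw [marginal_apply, Finset.expect_sum_comm]
        gcongr with α
        exact smul_sub_conj_le_expect_ite_seqMeas hK.le ha.nonneg (hsa α) u (hpow α)

end SequentialMeasurement

section OptimalStrategy

variable {A B : Type*} [CStarAlgebra A] [PartialOrder A] [StarOrderedRing A] [Module ℚ≥0 A]
  [CStarAlgebra B] [PartialOrder B] [StarOrderedRing B] [Module ℚ≥0 B]
  {ι κ : Type*} [Fintype ι] [DecidableEq ι] [Fintype κ] [DecidableEq κ]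

/-- The error term of `exists_isStrategy_smul_le_marginal` is harmless at a family that is nearly
optimal for `Φ`. -/
theorem exists_isStrategy_le_mul_map_marginal {K : ℝ} {n : ℕ}
    (hn : (n : ℝ) * K = Fintype.card ι) {Φ : (ι → A) →ₗ[ℝ] ℝ} (hΦ : Monotone Φ) :
    ∃ P : Fin n → (Fin n → ι) → A, IsStrategy P ∧
      ∀ a, IsBoundedFamily K a → Φ a ≤ 16 * Φ (marginal P) := by
  let values : Set ℝ := Φ '' {a | IsBoundedFamily K a}
  have hbdd : BddAbove values := by
    refine ⟨Φ 1, ?_⟩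
    rintro _ ⟨a, ha, rfl⟩
    exact hΦ fun u =>
      (Finset.single_le_sum (fun v _ => ha.nonneg v) (Finset.mem_univ u)).trans ha.sum_le_one
  have hle_sup {a : ι → A} (ha : IsBoundedFamily K a) : Φ a ≤ sSup values :=
    le_csSup hbdd ⟨a, ha, rfl⟩
  have hsup : 0 ≤ sSup values := by simpa using hle_sup .zero
  obtain ⟨a, ha, hlt⟩ : ∃ a, IsBoundedFamily K a ∧ 2 / 3 * sSup values ≤ Φ a := by
    rcases hsup.eq_or_lt with h0 | hpos
    · exact ⟨0, .zero, by simp [← h0]⟩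
    · obtain ⟨_, ⟨a, ha, rfl⟩, hlt⟩ := exists_lt_of_lt_csSup ⟨Φ 0, Set.mem_image_of_mem Φ .zero⟩
        (show 2 / 3 * sSup values < sSup values by linarith)
      exact ⟨a, ha, hlt.le⟩
  obtain ⟨P, hP, a', ha', hPa⟩ := exists_isStrategy_smul_le_marginal hn ha
  have key : 3 * Φ a ≤ 16 * Φ (marginal P) + Φ a' := by
    simpa using hΦ (show (3 : ℝ) • a ≤ (16 : ℝ) • marginal P + a' from hPa)
  refine ⟨P, hP, fun b hb => ?_⟩
  linarith [hle_sup hb, hle_sup ha']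

theorem exists_isStrategy_pair {K L : ℝ} {n m : ℕ} (hn : (n : ℝ) * K = Fintype.card ι)
    (hm : (m : ℝ) * L = Fintype.card κ) {T : (κ → B) →ₗ[ℝ] (ι → A) →ₗ[ℝ] ℝ}
    (hT : ∀ c a, 0 ≤ c → 0 ≤ a → 0 ≤ T c a) {c : κ → B} {a : ι → A}
    (hc : IsBoundedFamily L c) (ha : IsBoundedFamily K a) :
    ∃ (P : Fin n → (Fin n → ι) → A) (R : Fin m → (Fin m → κ) → B), IsStrategy P ∧ IsStrategy R ∧
      T c a ≤ 256 * T (marginal R) (marginal P) := by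
  have mono_right : Monotone (T c) :=
    (monotone_iff_map_nonneg _).2 fun a ha => hT c a hc.nonneg ha
  obtain ⟨P, hP, hPa⟩ := exists_isStrategy_le_mul_map_marginal hn mono_right
  have mono_left : Monotone (T.flip (marginal P)) :=
    (monotone_iff_map_nonneg _).2 fun c hc => hT c _ hc (hP.isBoundedFamily_marginal hn).nonneg
  obtain ⟨R, hR, hRc⟩ := exists_isStrategy_le_mul_map_marginal hm mono_left
  refine ⟨P, R, hP, hR, ?_⟩
  calc T c a ≤ 16 * T c (marginal P) := hPa a ha
    _ ≤ 16 * (16 * T (marginal R) (marginal P)) := by gcongr; exact hRc c hc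
    _ = 256 * T (marginal R) (marginal P) := by ring

end OptimalStrategy

section WeightedMap

variable {A B E ι κ : Type*} [AddCommGroup A] [Module ℝ A] [AddCommGroup B] [Module ℝ B]
  [AddCommGroup E] [Module ℝ E] [Fintype ι] [Fintype κ]

/-- The bilinear map on families which a weight `w` on the pairs of indices and a bilinear map `β`
on the coefficients induce. -/
noncomputable def weightedMap (w : κ → ι → ℝ) (β : B →ₗ[ℝ] A →ₗ[ℝ] E) :
    (κ → B) →ₗ[ℝ] (ι → A) →ₗ[ℝ] E :=
  ∑ v, ∑ u, w v u • β.compl₁₂ (LinearMap.proj v) (LinearMap.proj u)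

theorem weightedMap_apply (w : κ → ι → ℝ) (β : B →ₗ[ℝ] A →ₗ[ℝ] E) (c : κ → B) (a : ι → A) :
    weightedMap w β c a = ∑ v, ∑ u, w v u • β (c v) (a u) := by
  simp [weightedMap]

theorem map_weightedMap {F : Type*} [AddCommGroup F] [Module ℝ F] (g : E →ₗ[ℝ] F)
    (w : κ → ι → ℝ) (β : B →ₗ[ℝ] A →ₗ[ℝ] E) (c : κ → B) (a : ι → A) :
    g (weightedMap w β c a) = weightedMap w (β.compr₂ g) c a := by
  simp [weightedMap_apply]

theorem weightedMap_single_single [DecidableEq ι] [DecidableEq κ] (w : κ → ι → ℝ)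
    (β : B →ₗ[ℝ] A →ₗ[ℝ] E) (v : κ) (u : ι) (y : B) (x : A) :
    weightedMap w β (Pi.single v y) (Pi.single u x) = w v u • β y x := by
  rw [weightedMap_apply, Fintype.sum_eq_single v, Fintype.sum_eq_single u]
  · simp
  · intro u' hu
    simp [hu]
  · intro v' hv
    simp [hv]

theorem weightedMap_nonneg [PartialOrder A] [PartialOrder B] [PartialOrder E]
    [IsOrderedAddMonoid E] [PosSMulMono ℝ E] {w : κ → ι → ℝ} (hw : ∀ v u, 0 ≤ w v u)
    {β : B →ₗ[ℝ] A →ₗ[ℝ] E} (hβ : ∀ y x, 0 ≤ y → 0 ≤ x → 0 ≤ β y x) (c : κ → B) (a : ι → A)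
    (hc : 0 ≤ c) (ha : 0 ≤ a) : 0 ≤ weightedMap w β c a := by
  rw [weightedMap_apply]
  exact Finset.sum_nonneg fun v _ => Finset.sum_nonneg fun u _ =>
    smul_nonneg (hw v u) (hβ _ _ (hc v) (ha u))

end WeightedMap

section EdgeWeight

variable {N M D : ℕ}

/-- The probability that `G u s = v` for a uniform seed `s`. -/
noncomputable def edgeWeight (G : Fin N → Fin D → Fin M) (v : Fin M) (u : Fin N) : ℝ :=
  𝔼 s, edgeIndicator G u s v

theorem edgeWeight_nonneg (G : Fin N → Fin D → Fin M) (v : Fin M) (u : Fin N) :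
    0 ≤ edgeWeight G v u :=
  Finset.expect_nonneg fun s _ => by
    unfold edgeIndicator
    positivity

theorem conMap_apply (f : Fin D → Fin N → Fin M) (x : Fin N → ℂ) (v : Fin M) :
    conMap f x v = ∑ u, edgeWeight (neighbor f) v u • x u := by
  have entry (s u) : functionMatrix (f s) v u = (edgeIndicator (neighbor f) u s v : ℂ) := by
    by_cases h : f s u = v <;> simp [edgeIndicator, neighbor, functionMatrix, h]
  simp only [conMap, Matrix.mulVecLin_apply, Matrix.mulVec, dotProduct, Matrix.smul_apply,
    Matrix.sum_apply, edgeWeight, Fintype.expect_eq_sum_div_card, Fintype.card_fin, entry]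
  refine Finset.sum_congr rfl fun u _ => ?_
  rw [Complex.real_smul, smul_eq_mul, div_eq_inv_mul]
  push_cast
  rfl

theorem amplification_conMap (f : Fin D → Fin N → Fin M) {Q : ℕ} (x : MatOver Q N) (v : Fin M) :
    amplification (conMap f) x v = ∑ u, edgeWeight (neighbor f) v u • x u := by
  ext i j
  simp [amplification, conMap_apply, Matrix.sum_apply]

theorem expect_edgeIndicator_mul_eq_weightedMap {A B : Type*} [AddCommGroup A] [Module ℝ A]
    [Module ℚ≥0 A] [AddCommGroup B] [Module ℝ B] [Module ℚ≥0 B] {n m : ℕ}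
    (G : Fin N → Fin D → Fin M) (β : B →ₗ[ℝ] A →ₗ[ℝ] ℝ) (P : Fin n → (Fin n → Fin N) → A)
    (R : Fin m → (Fin m → Fin M) → B) :
    𝔼 s : Fin D, 𝔼 x : Fin n → Fin N, 𝔼 y : Fin m → Fin M, ∑ i, ∑ j,
        edgeIndicator G (x i) s (y j) * β (R j y) (P i x) =
      weightedMap (edgeWeight G) β (marginal R) (marginal P) := by
  calc _ = 𝔼 x : Fin n → Fin N, 𝔼 y : Fin m → Fin M, ∑ i, ∑ j,
        edgeWeight G (y j) (x i) * β (R j y) (P i x) := by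
        simp only [edgeWeight, Finset.expect_mul, ← Finset.expect_sum_comm]
        rw [Finset.expect_comm]
        exact Finset.expect_congr rfl fun x _ => Finset.expect_comm ..
    _ = 𝔼 x : Fin n → Fin N, ∑ i,
        weightedMap (edgeWeight G) β (marginal R) (Pi.single (x i) (P i x)) := by
        refine Finset.expect_congr rfl fun x _ => ?_
        rw [Finset.expect_sum_comm]
        refine Finset.sum_congr rfl fun i _ => ?_
        rw [← LinearMap.flip_apply, map_marginal]
        simp only [LinearMap.flip_apply, weightedMap_single_single, smul_eq_mul]
    _ = weightedMap (edgeWeight G) β (marginal R) (marginal P) := (map_marginal ..).symm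

end EdgeWeight

section VectorForm

open scoped MatrixOrder Matrix.Norms.L2Operator

variable {m n : Type*} [Fintype m] [Fintype n]

/-- The functional `T ↦ Re ⟨φ, T φ⟩` of a vector `φ`, which need not be a unit vector. -/
noncomputable def vectorForm (φ : n → ℂ) : Matrix n n ℂ →ₗ[ℝ] ℝ where
  toFun T := (star φ ⬝ᵥ T *ᵥ φ).re
  map_add' S T := by rw [Matrix.add_mulVec, dotProduct_add, Complex.add_re]
  map_smul' r T := by rw [Matrix.smul_mulVec, dotProduct_smul, Complex.smul_re, RingHom.id_apply]

theorem vectorForm_apply (φ : n → ℂ) (T : Matrix n n ℂ) :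
    vectorForm φ T = (star φ ⬝ᵥ T *ᵥ φ).re :=
  rfl

theorem vectorForm_mulVec (S : Matrix m n ℂ) (φ : n → ℂ) (T : Matrix m m ℂ) :
    vectorForm (S *ᵥ φ) T = vectorForm φ (Sᴴ * T * S) := by
  simp only [vectorForm_apply, Matrix.star_mulVec, ← Matrix.dotProduct_mulVec,
    Matrix.mulVec_mulVec, Matrix.mul_assoc]

theorem vectorForm_nonneg (φ : n → ℂ) {T : Matrix n n ℂ} (hT : 0 ≤ T) : 0 ≤ vectorForm φ T :=
  (Complex.le_def.1 ((Matrix.nonneg_iff_posSemidef.1 hT).dotProduct_mulVec_nonneg φ)).1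

theorem le_iff_forall_vectorForm_le {S T : Matrix n n ℂ} (hS : S.IsHermitian)
    (hT : T.IsHermitian) : S ≤ T ↔ ∀ φ, vectorForm φ S ≤ vectorForm φ T := by
  have him (φ : n → ℂ) : (star φ ⬝ᵥ (T - S) *ᵥ φ).im = 0 :=
    (hT.sub hS).im_star_dotProduct_mulVec_self φ
  simp only [Matrix.le_iff, Matrix.posSemidef_iff_dotProduct_mulVec, hT.sub hS, true_and,
    Complex.nonneg_iff, him, and_true, ← vectorForm_apply, map_sub, sub_nonneg]

theorem vectorForm_smul (r : ℝ) (φ : n → ℂ) (T : Matrix n n ℂ) :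
    vectorForm (r • φ) T = r ^ 2 * vectorForm φ T := by
  rw [vectorForm_apply, Matrix.mulVec_smul, star_smul, smul_dotProduct, dotProduct_smul,
    star_trivial, smul_smul, ← sq, Complex.smul_re, smul_eq_mul, vectorForm_apply]

variable [DecidableEq n]

theorem vectorForm_one (φ : n → ℂ) : (vectorForm φ 1 : ℂ) = star φ ⬝ᵥ φ := by
  rw [vectorForm_apply, Matrix.one_mulVec]
  exact (Complex.eq_re_of_ofReal_le (dotProduct_star_self_nonneg φ)).symm

theorem vectorForm_le_norm {φ : n → ℂ} (hφ : star φ ⬝ᵥ φ = 1) {T : Matrix n n ℂ}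
    (hT : T.IsHermitian) : vectorForm φ T ≤ ‖T‖ := by
  have h1 : vectorForm φ 1 = 1 := by
    exact_mod_cast (vectorForm_one φ).trans hφ
  have hle : T ≤ ‖T‖ • (1 : Matrix n n ℂ) := by
    rw [← Algebra.algebraMap_eq_smul_one]
    exact IsSelfAdjoint.le_algebraMap_norm_self hT
  simpa [h1] using (le_iff_forall_vectorForm_le hT (.smul Matrix.isHermitian_one (.all _))).1 hle φ

theorem le_smul_one_of_forall_unit {T : Matrix n n ℂ} (hT : T.IsHermitian) {r : ℝ}
    (h : ∀ φ, star φ ⬝ᵥ φ = 1 → vectorForm φ T ≤ r) : T ≤ r • 1 := by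
  refine (le_iff_forall_vectorForm_le hT (.smul Matrix.isHermitian_one (.all _))).2 fun φ => ?_
  rw [map_smul, smul_eq_mul]
  rcases eq_or_ne φ 0 with rfl | hφ
  · simp [vectorForm_apply]
  have hpos : 0 < vectorForm φ 1 := by
    have := Matrix.dotProduct_star_self_pos_iff.2 hφ
    rwa [← vectorForm_one, Complex.zero_lt_real] at this
  set s : ℝ := √(vectorForm φ 1)
  have hs : s ^ 2 = vectorForm φ 1 := Real.sq_sqrt hpos.le
  have hunit : star (s⁻¹ • φ) ⬝ᵥ (s⁻¹ • φ) = 1 := by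
    rw [← vectorForm_one, vectorForm_smul, inv_pow, hs, inv_mul_cancel₀ hpos.ne',
      Complex.ofReal_one]
  have := h _ hunit
  rwa [vectorForm_smul, inv_pow, hs, inv_mul_le_iff₀ hpos, mul_comm] at this

theorem mul_conjTranspose_le_smul_one_iff [DecidableEq m] (T : Matrix m n ℂ) {r : ℝ}
    (hr : 0 ≤ r) : T * Tᴴ ≤ r • (1 : Matrix m m ℂ) ↔ ‖T‖ ^ 2 ≤ r := by
  have hnorm : ‖T * Tᴴ‖ = ‖T‖ ^ 2 := by
    have := Matrix.l2_opNorm_conjTranspose_mul_self (𝕜 := ℂ) Tᴴ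
    rwa [Matrix.conjTranspose_conjTranspose, Matrix.l2_opNorm_conjTranspose, ← sq] at this
  rw [← Algebra.algebraMap_eq_smul_one, ← hnorm, CStarAlgebra.norm_le_iff_le_algebraMap _ hr
    (Matrix.posSemidef_self_mul_conjTranspose T).nonneg]

end VectorForm

section WeightedKron

open scoped MatrixOrder Matrix.Norms.L2Operator

variable {ι κ m n p q : Type*} [Fintype ι] [Fintype κ]

/-- The weighted sum `∑ w(v, u) z(v) ⊗ x(u)` of the Kronecker products of two families. -/
noncomputable abbrev weightedKron (w : κ → ι → ℝ) :
    (κ → Matrix m m ℂ) →ₗ[ℝ] (ι → Matrix n n ℂ) →ₗ[ℝ] Matrix (m × n) (m × n) ℂ :=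
  weightedMap w Matrix.kroneckerBilinear

theorem weightedKron_apply (w : κ → ι → ℝ) (z : κ → Matrix m m ℂ) (x : ι → Matrix n n ℂ) :
    weightedKron w z x = ∑ v, ∑ u, w v u • (z v ⊗ₖ x u) :=
  weightedMap_apply w _ z x

theorem weightedKron_nonneg [Finite m] [Finite n] {w : κ → ι → ℝ}
    (hw : ∀ v u, 0 ≤ w v u) {z : κ → Matrix m m ℂ} {x : ι → Matrix n n ℂ} (hz : 0 ≤ z)
    (hx : 0 ≤ x) : 0 ≤ weightedKron w z x := by
  have := Fintype.ofFinite m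
  have := Fintype.ofFinite n
  classical
  exact weightedMap_nonneg hw (fun _ _ hY hX => ((Matrix.nonneg_iff_posSemidef.1 hY).kronecker
    (Matrix.nonneg_iff_posSemidef.1 hX)).nonneg) z x hz hx

theorem isHermitian_weightedKron [Finite m] [Finite n] {w : κ → ι → ℝ}
    (hw : ∀ v u, 0 ≤ w v u) {z : κ → Matrix m m ℂ} {x : ι → Matrix n n ℂ} (hz : 0 ≤ z)
    (hx : 0 ≤ x) : (weightedKron w z x).IsHermitian :=
  (Matrix.nonneg_iff_posSemidef.1 (weightedKron_nonneg hw hz hx)).isHermitian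

variable [Fintype m] [Fintype n]

theorem conjTranspose_mul_weightedKron_mul [DecidableEq n] (w : κ → ι → ℝ) (S : Matrix m p ℂ)
    (z : κ → Matrix m m ℂ) (x : ι → Matrix n n ℂ) :
    (S ⊗ₖ (1 : Matrix n n ℂ))ᴴ * weightedKron w z x * (S ⊗ₖ (1 : Matrix n n ℂ)) =
      weightedKron w (fun v => Sᴴ * z v * S) x := by
  have hkron (Y : Matrix m m ℂ) (X : Matrix n n ℂ) :
      (S ⊗ₖ (1 : Matrix n n ℂ))ᴴ * (Y ⊗ₖ X) * (S ⊗ₖ (1 : Matrix n n ℂ)) = (Sᴴ * Y * S) ⊗ₖ X := by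
    rw [Matrix.conjTranspose_kronecker, ← Matrix.mul_kronecker_mul, ← Matrix.mul_kronecker_mul,
      Matrix.conjTranspose_one, one_mul, mul_one]
  simp only [weightedKron_apply, Matrix.mul_sum, Matrix.sum_mul, Matrix.mul_smul,
    Matrix.smul_mul, hkron]

end WeightedKron

section Factorization

open scoped MatrixOrder Matrix.Norms.L2Operator

variable {ι κ m n p q : Type*} [Fintype ι] [Fintype κ] [Fintype p] [Fintype q]

/-- The block row with the blocks `√w(v, u) c(v) ⊗ a(u)`. It turns a weighted sum of Kronecker
products of factorized matrices into a product of two matrices. -/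
noncomputable def weightedKronRow (w : κ → ι → ℝ) (c : κ → Matrix m p ℂ) (a : ι → Matrix n q ℂ) :
    Matrix (m × n) ((κ × ι) × p × q) ℂ :=
  Matrix.of fun i k => √(w k.1.1 k.1.2) * (c k.1.1 ⊗ₖ a k.1.2) i k.2

theorem weightedKronRow_mul_conjTranspose {w : κ → ι → ℝ} (hw : ∀ v u, 0 ≤ w v u)
    (c d : κ → Matrix m p ℂ) (a b : ι → Matrix n q ℂ) :
    weightedKronRow w c a * (weightedKronRow w d b)ᴴ =
      weightedKron w (fun v => c v * (d v)ᴴ) fun u => a u * (b u)ᴴ := by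
  have hkron (v : κ) (u : ι) : (c v * (d v)ᴴ) ⊗ₖ (a u * (b u)ᴴ) =
      (c v ⊗ₖ a u) * (d v ⊗ₖ b u)ᴴ := by
    rw [Matrix.conjTranspose_kronecker, Matrix.mul_kronecker_mul]
  ext i j
  simp only [weightedKron_apply, hkron, Matrix.sum_apply, Matrix.smul_apply, Matrix.mul_apply,
    Matrix.conjTranspose_apply, weightedKronRow, Matrix.of_apply, Fintype.sum_prod_type,
    Complex.real_smul, Finset.mul_sum, star_mul', Complex.star_def, Complex.conj_ofReal]
  refine Finset.sum_congr rfl fun v _ => Finset.sum_congr rfl fun u _ =>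
    Finset.sum_congr rfl fun k _ => Finset.sum_congr rfl fun l _ => ?_
  rw [mul_mul_mul_comm, ← Complex.ofReal_mul, Real.mul_self_sqrt (hw v u)]

variable [Fintype m] [Fintype n] [DecidableEq m] [DecidableEq n]

theorem norm_weightedKron_mul_conjTranspose_le {w : κ → ι → ℝ} (hw : ∀ v u, 0 ≤ w v u)
    {c d : κ → Matrix m p ℂ} {a b : ι → Matrix n q ℂ} {r : ℝ} (hr : 0 ≤ r)
    (hca : weightedKron w (fun v => c v * (c v)ᴴ) (fun u => a u * (a u)ᴴ) ≤ r • 1)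
    (hdb : weightedKron w (fun v => d v * (d v)ᴴ) (fun u => b u * (b u)ᴴ) ≤ r • 1) :
    ‖weightedKron w (fun v => c v * (d v)ᴴ) fun u => a u * (b u)ᴴ‖ ≤ r := by
  classical
  rw [← weightedKronRow_mul_conjTranspose hw, mul_conjTranspose_le_smul_one_iff _ hr] at hca hdb
  rw [← weightedKronRow_mul_conjTranspose hw]
  calc _ ≤ ‖weightedKronRow w c a‖ * ‖weightedKronRow w d b‖ := by
        rw [← Matrix.l2_opNorm_conjTranspose (weightedKronRow w d b)]
        exact Matrix.l2_opNorm_mul ..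
    _ ≤ √r * √r := by
        gcongr
        exacts [Real.le_sqrt_of_sq_le hca, Real.le_sqrt_of_sq_le hdb]
    _ = r := Real.mul_self_sqrt hr

end Factorization

section Compression

open scoped MatrixOrder Matrix.Norms.L2Operator

variable {ι κ m n : Type*} [Fintype ι] [Fintype κ] [Fintype m] [Fintype n] [DecidableEq n]

theorem vectorForm_vec_transpose_one [DecidableEq m] (X : Matrix m n ℂ) :
    (vectorForm (Matrix.vec Xᵀ) 1 : ℂ) = (Xᴴ * X).trace := by
  rw [vectorForm_one, Matrix.star_vec_dotProduct_vec, ← Matrix.trace_transpose,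
    Matrix.transpose_mul, Matrix.transpose_transpose, Matrix.trace_mul_comm,
    Matrix.transpose_conjTranspose]
  rfl

theorem exists_eq_mul_of_pos (X : Matrix m n ℂ) {ε : ℝ} (hε : 0 < ε) :
    ∃ (S : Matrix m n ℂ) (B : Matrix n n ℂ), Sᴴ * S ≤ 1 ∧ X = S * B ∧
      Bᴴ * B = Xᴴ * X + ε • 1 := by
  obtain ⟨B, hB, hBX⟩ := CStarAlgebra.isStrictlyPositive_iff_eq_star_mul_self.mp
    (Matrix.PosDef.posSemidef_add (Matrix.posSemidef_conjTranspose_mul_self X)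
      (Matrix.PosDef.one.smul hε)).isStrictlyPositive
  rw [Matrix.star_eq_conjTranspose] at hBX
  have hdet : IsUnit B.det := (Matrix.isUnit_iff_isUnit_det B).1 hB
  refine ⟨X * B⁻¹, B, ?_, ?_, hBX.symm⟩
  · have hle : Xᴴ * X ≤ Bᴴ * B := by
      rw [← hBX]
      exact le_add_of_nonneg_right (smul_nonneg hε.le Matrix.PosSemidef.one.nonneg)
    calc (X * B⁻¹)ᴴ * (X * B⁻¹) = star B⁻¹ * (Xᴴ * X) * B⁻¹ := by
          simp only [Matrix.conjTranspose_mul, Matrix.star_eq_conjTranspose, Matrix.mul_assoc]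
      _ ≤ star B⁻¹ * (Bᴴ * B) * B⁻¹ := star_left_conjugate_le_conjugate hle _
      _ = star (B * B⁻¹) * (B * B⁻¹) := by
          simp only [star_mul, Matrix.star_eq_conjTranspose, Matrix.mul_assoc]
      _ = 1 := by rw [Matrix.mul_nonsing_inv _ hdet, star_one, one_mul]
  · rw [Matrix.mul_assoc, Matrix.nonsing_inv_mul _ hdet, Matrix.mul_one]

variable [DecidableEq m]

theorem IsBoundedFamily.compress {K : ℝ} {c : κ → Matrix m m ℂ} (hc : IsBoundedFamily K c)
    {S : Matrix m n ℂ} (hS : Sᴴ * S ≤ 1) : IsBoundedFamily K fun v => Sᴴ * c v * S := by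
  have hmono {X Y : Matrix m m ℂ} (h : X ≤ Y) : Sᴴ * X * S ≤ Sᴴ * Y * S := by
    rw [Matrix.le_iff, ← Matrix.sub_mul, ← Matrix.mul_sub]
    exact (Matrix.le_iff.1 h).conjTranspose_mul_mul_same S
  have hone {X : Matrix m m ℂ} (h : X ≤ 1) : Sᴴ * X * S ≤ 1 :=
    (hmono h).trans (by rwa [Matrix.mul_one])
  refine ⟨fun v => by simpa using hmono (hc.nonneg v), fun v => ?_, ?_⟩
  · simpa only [Matrix.mul_smul, Matrix.smul_mul] using hone (hc.smul_le_one v)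
  · simpa only [Matrix.mul_sum, Matrix.sum_mul] using hone hc.sum_le_one

/-- A vector of `ℂᵐ ⊗ ℂⁿ` has Schmidt rank at most `n`, so up to `ε` it is the image `(S ⊗ 1) φ'`
of a vector `φ'` of `ℂⁿ ⊗ ℂⁿ` under a contraction `S`, which can be moved to the family `c`. -/
theorem weightedKron_le_smul_one_of_forall {w : κ → ι → ℝ} (hw : ∀ v u, 0 ≤ w v u) {K r : ℝ}
    {x : ι → Matrix n n ℂ} (hx : 0 ≤ x)
    (h : ∀ c : κ → Matrix n n ℂ, IsBoundedFamily K c → weightedKron w c x ≤ r • 1)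
    {c : κ → Matrix m m ℂ} (hc : IsBoundedFamily K c) : weightedKron w c x ≤ r • 1 := by
  refine (le_iff_forall_vectorForm_le (isHermitian_weightedKron hw hc.nonneg hx)
    (.smul Matrix.isHermitian_one (.all _))).2 fun φ => ?_
  obtain ⟨X, rfl⟩ : ∃ X : Matrix m n ℂ, φ = Matrix.vec Xᵀ := ⟨.of fun i j => φ (i, j), rfl⟩
  have bound {ε : ℝ} (hε : 0 < ε) : vectorForm (Matrix.vec Xᵀ) (weightedKron w c x) ≤
      r * (vectorForm (Matrix.vec Xᵀ) 1 + ε * Fintype.card n) := by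
    obtain ⟨S, B, hS, hX, hB⟩ := exists_eq_mul_of_pos X hε
    have hvec : Matrix.vec Xᵀ = (S ⊗ₖ (1 : Matrix n n ℂ)) *ᵥ Matrix.vec Bᵀ := by
      rw [Matrix.kronecker_mulVec_vec, one_mul, ← Matrix.transpose_mul, hX]
    have hnorm : vectorForm (Matrix.vec Bᵀ) 1 =
        vectorForm (Matrix.vec Xᵀ) 1 + ε * Fintype.card n := by
      apply Complex.ofReal_injective
      push_cast
      rw [vectorForm_vec_transpose_one, vectorForm_vec_transpose_one, hB, Matrix.trace_add,
        Matrix.trace_smul, Matrix.trace_one, Complex.real_smul]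
    have hcS := hc.compress hS
    rw [← hnorm, hvec, vectorForm_mulVec, conjTranspose_mul_weightedKron_mul, ← smul_eq_mul,
      ← map_smul]
    exact (le_iff_forall_vectorForm_le (isHermitian_weightedKron hw hcS.nonneg hx)
      (.smul Matrix.isHermitian_one (.all _))).1 (h _ hcS) _
  have hlim : Filter.Tendsto
      (fun ε : ℝ => r * (vectorForm (Matrix.vec Xᵀ) 1 + ε * Fintype.card n))
      (nhdsWithin 0 (Set.Ioi 0)) (nhds (r * vectorForm (Matrix.vec Xᵀ) 1)) :=
    (Continuous.tendsto' (by fun_prop) _ _ (by simp)).mono_left nhdsWithin_le_nhds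
  rw [map_smul, smul_eq_mul]
  exact ge_of_tendsto hlim (Filter.eventually_of_mem self_mem_nhdsWithin fun ε => bound)

end Compression

section CapCap

open scoped MatrixOrder Matrix.Norms.L2Operator

theorem blockDiagonal_nonneg {m o : Type*} [Finite m] [Finite o] [DecidableEq o]
    {x : o → Matrix m m ℂ} (hx : 0 ≤ x) : 0 ≤ Matrix.blockDiagonal x := by
  classical
  have := Fintype.ofFinite m
  have := Fintype.ofFinite o
  choose s hs using fun u => CStarAlgebra.nonneg_iff_eq_mul_star_self.mp (hx u)
  rw [funext hs]
  simp only [Matrix.star_eq_conjTranspose]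
  rw [Matrix.blockDiagonal_mul s fun u => (s u)ᴴ, ← Matrix.blockDiagonal_conjTranspose]
  exact (Matrix.posSemidef_self_mul_conjTranspose _).nonneg

variable {Q N : ℕ} {K : ℝ}

/-- The rows of `a` that belong to the block `u`. -/
def rowBlock (a : Matrix (Fin Q × Fin N) (Fin Q × Fin N) ℂ) (u : Fin N) :
    Matrix (Fin Q) (Fin Q × Fin N) ℂ :=
  a.submatrix (fun i => (i, u)) id

theorem rowBlock_smul (r : ℝ) (a : Matrix (Fin Q × Fin N) (Fin Q × Fin N) ℂ) (u : Fin N) :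
    rowBlock (r • a) u = r • rowBlock a u :=
  rfl

theorem rowBlock_mul_conjTranspose (a b : Matrix (Fin Q × Fin N) (Fin Q × Fin N) ℂ) (u : Fin N) :
    rowBlock a u * (rowBlock b u)ᴴ =
      (a * bᴴ).submatrix (fun i => (i, u)) fun i => (i, u) := by
  rw [rowBlock, rowBlock, Matrix.conjTranspose_submatrix,
    Matrix.submatrix_mul _ _ _ _ _ Function.bijective_id]

theorem reshuffle_mul_conjTranspose (a : Matrix (Fin Q × Fin N) (Fin Q × Fin N) ℂ) :
    reshuffle a * (reshuffle a)ᴴ = ∑ u, rowBlock a u * (rowBlock a u)ᴴ := by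
  ext i j
  simp only [Matrix.mul_apply, reshuffle, Matrix.of_apply, Matrix.conjTranspose_apply,
    Fintype.sum_prod_type, Matrix.sum_apply, rowBlock, Matrix.submatrix_apply, id]
  rw [Finset.sum_comm]

theorem factorNorm_nonneg (a : Matrix (Fin Q × Fin N) (Fin Q × Fin N) ℂ) : 0 ≤ factorNorm K a :=
  (norm_nonneg (reshuffle a)).trans (le_max_right _ _)

theorem factorNorm_smul {r : ℝ} (hr : 0 ≤ r) (a : Matrix (Fin Q × Fin N) (Fin Q × Fin N) ℂ) :
    factorNorm K (r • a) = r * factorNorm K a := by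
  have h (m n : Type) [Fintype m] [Fintype n] [DecidableEq n] (T : Matrix m n ℂ) :
      opNorm (r • T) = r * opNorm T := (norm_smul r T).trans (by rw [Real.norm_of_nonneg hr]; rfl)
  rw [factorNorm, factorNorm, mul_max_of_nonneg _ _ hr, ← h, h, mul_left_comm]
  rfl

theorem factorNorm_le_one_iff (hK : 0 ≤ K) (a : Matrix (Fin Q × Fin N) (Fin Q × Fin N) ℂ) :
    factorNorm K a ≤ 1 ↔ K • (a * aᴴ) ≤ 1 ∧ ∑ u, rowBlock a u * (rowBlock a u)ᴴ ≤ 1 := by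
  have hle {m n : Type} [Fintype m] [Fintype n] [DecidableEq m] [DecidableEq n]
      (T : Matrix m n ℂ) : T * Tᴴ ≤ 1 ↔ ‖T‖ ≤ 1 := by
    rw [← one_smul ℝ (1 : Matrix m m ℂ), mul_conjTranspose_le_smul_one_iff T zero_le_one,
      sq_le_one_iff₀ (norm_nonneg T)]
  have hK2 : K • (a * aᴴ) = (√K • a) * (√K • a)ᴴ := by
    rw [Matrix.conjTranspose_smul, star_trivial, smul_mul_smul_comm, Real.mul_self_sqrt hK]
  rw [factorNorm, max_le_iff, ← reshuffle_mul_conjTranspose, hK2, hle, hle, norm_smul,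
    Real.norm_of_nonneg (Real.sqrt_nonneg K)]
  rfl

theorem IsBoundedFamily.capCap_le_one (hK : 0 ≤ K) {x : MatOver Q N}
    (hx : IsBoundedFamily K x) : capCap N K Q x ≤ 1 := by
  choose s hs using fun u => CStarAlgebra.nonneg_iff_eq_mul_star_self.mp (hx.nonneg u)
  have hfactor : Matrix.blockDiagonal s * (Matrix.blockDiagonal s)ᴴ = Matrix.blockDiagonal x := by
    rw [Matrix.blockDiagonal_conjTranspose, ← Matrix.blockDiagonal_mul]
    exact congrArg _ (funext hs).symm
  have hone : factorNorm K (Matrix.blockDiagonal s) ≤ 1 := by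
    simp only [factorNorm_le_one_iff hK, rowBlock_mul_conjTranspose, hfactor]
    constructor
    · rw [← sub_nonneg, ← Matrix.blockDiagonal_one, ← Matrix.blockDiagonal_smul,
        ← Matrix.blockDiagonal_sub]
      exact blockDiagonal_nonneg fun u => sub_nonneg.2 (hx.smul_le_one u)
    · convert hx.sum_le_one with u
      ext i j
      simp
  refine iInf₂_le_of_le _ _ (iInf_le_of_le hfactor (ENNReal.ofReal_le_one.2 ?_))
  exact mul_le_one₀ hone (factorNorm_nonneg _) hone

theorem isBoundedFamily_rowBlock_mul_conjTranspose (hK : 0 ≤ K)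
    {a : Matrix (Fin Q × Fin N) (Fin Q × Fin N) ℂ} (ha : factorNorm K a ≤ 1) :
    IsBoundedFamily K fun u => rowBlock a u * (rowBlock a u)ᴴ := by
  obtain ⟨hmul, hsum⟩ := (factorNorm_le_one_iff hK a).1 ha
  refine ⟨fun u => (Matrix.posSemidef_self_mul_conjTranspose _).nonneg, fun u => ?_, hsum⟩
  have := (Matrix.le_iff.1 hmul).submatrix fun i : Fin Q => (i, u)
  rw [rowBlock_mul_conjTranspose, Matrix.le_iff]
  convert this using 1
  ext i j
  simp [Matrix.one_apply]

theorem exists_factorization_of_capCap_lt {x : MatOver Q N} {η : ℝ}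
    (hx : capCap N K Q x < ENNReal.ofReal η) :
    ∃ a b : Matrix (Fin Q × Fin N) (Fin Q × Fin N) ℂ, factorNorm K a ≤ 1 ∧ factorNorm K b ≤ 1 ∧
      ∃ s, 0 ≤ s ∧ s ≤ η ∧ ∀ u, x u = s • (rowBlock a u * (rowBlock b u)ᴴ) := by
  simp only [capCap, iInf_lt_iff] at hx
  obtain ⟨a, b, hab, hlt⟩ := hx
  have hlt : factorNorm K a * factorNorm K b < η := ENNReal.ofReal_lt_ofReal_iff_of_nonneg
    (mul_nonneg (factorNorm_nonneg a) (factorNorm_nonneg b)) |>.1 hlt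
  obtain ⟨s, hs, t, ht, hst⟩ : ∃ s > factorNorm K a, ∃ t > factorNorm K b, s * t < η := by
    contrapose! hlt
    exact le_mul_of_forall_lt₀ hlt
  have hs0 : 0 < s := (factorNorm_nonneg a).trans_lt hs
  have ht0 : 0 < t := (factorNorm_nonneg b).trans_lt ht
  have normalize {r : ℝ} (hr : 0 < r) {c : Matrix (Fin Q × Fin N) (Fin Q × Fin N) ℂ}
      (hc : factorNorm K c < r) : factorNorm K (r⁻¹ • c) ≤ 1 := by
    rw [factorNorm_smul (inv_nonneg.2 hr.le)]
    exact (inv_mul_lt_one₀ hr).2 hc |>.le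
  refine ⟨s⁻¹ • a, t⁻¹ • b, normalize hs0 hs, normalize ht0 ht, s * t, by positivity, hst.le,
    fun u => ?_⟩
  have hone : s * t * s⁻¹ * t⁻¹ = 1 := by field_simp
  rw [rowBlock_smul, rowBlock_smul, Matrix.conjTranspose_smul, star_trivial, Matrix.smul_mul,
    Matrix.mul_smul, smul_smul, smul_smul, hone, one_smul, rowBlock_mul_conjTranspose, hab]
  ext i j
  simp

end CapCap

section EntangledValue

open scoped MatrixOrder Matrix.Norms.L2Operator

theorem isPOVMFamily_iff_isStrategy {O Ω : Type} [Fintype O] {Q : ℕ}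
    (p : O → Ω → Matrix (Fin Q) (Fin Q) ℂ) : IsPOVMFamily p ↔ IsStrategy p := by
  simp only [IsPOVMFamily, ← Matrix.nonneg_iff_posSemidef, sub_nonneg]
  exact ⟨fun h => ⟨h.1, h.2⟩, fun h => ⟨h.1, h.2⟩⟩

theorem vectorForm_comp_equiv {m n : Type*} [Fintype m] [Fintype n] (φ : n → ℂ) (e : m ≃ n)
    (T : Matrix n n ℂ) : vectorForm (φ ∘ e) (T.submatrix e e) = vectorForm φ T := by
  rw [vectorForm_apply, vectorForm_apply, Matrix.submatrix_mulVec_equiv, Function.comp_assoc,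
    Equiv.self_comp_symm, Function.comp_id]
  exact congrArg _ (comp_equiv_dotProduct_comp_equiv (star φ) (T *ᵥ φ) e)

theorem vectorForm_comp_swap_kronecker {m n : Type*} [Fintype m] [Fintype n] (φ : m × n → ℂ)
    (X : Matrix m m ℂ) (Y : Matrix n n ℂ) :
    vectorForm (φ ∘ Prod.swap) (Y ⊗ₖ X) = vectorForm φ (X ⊗ₖ Y) := by
  rw [← vectorForm_comp_equiv φ (Equiv.prodComm n m)]
  congr 1
  ext i j
  exact mul_comm _ _

variable {N M D n m Q : ℕ}

theorem entangledValueDim_eq_iSup (G : Fin N → Fin D → Fin M) :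
    entangledValueDim G n m Q =
      ⨆ (φ : Fin Q × Fin Q → ℂ) (_ : star φ ⬝ᵥ φ = 1)
        (P : Fin n → (Fin n → Fin N) → Matrix (Fin Q) (Fin Q) ℂ) (_ : IsStrategy P)
        (R : Fin m → (Fin m → Fin M) → Matrix (Fin Q) (Fin Q) ℂ) (_ : IsStrategy R),
        ENNReal.ofReal (vectorForm φ (weightedKron (edgeWeight G) (marginal R) (marginal P))) := by
  simp only [entangledValueDim, isPOVMFamily_iff_isStrategy]
  refine ((Equiv.prodComm (Fin Q) (Fin Q)).arrowCongr (Equiv.refl ℂ)).iSup_congr fun ψ => ?_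
  have hψ : star (ψ ∘ Prod.swap) ⬝ᵥ (ψ ∘ Prod.swap) = star ψ ⬝ᵥ ψ :=
    comp_equiv_dotProduct_comp_equiv (star ψ) ψ (Equiv.prodComm (Fin Q) (Fin Q))
  refine iSup_congr_Prop (by rw [← hψ]; rfl) fun _ => iSup_congr fun P => iSup_congr fun _ =>
    iSup_congr fun R => iSup_congr fun _ => congrArg _ ?_
  rw [map_weightedMap, ← expect_edgeIndicator_mul_eq_weightedMap]
  simp only [← vectorForm_apply, ← vectorForm_comp_swap_kronecker ψ]
  rfl

theorem inv_mul_amplifiedNorm {K : ℝ} (hK : 0 < K) (E : MatNorms N) (f : Fin D → Fin N → Fin M) :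
    ENNReal.ofReal K⁻¹ * amplifiedNorm E (sigmaSigma M K) Q (conMap f) =
      ⨆ (x : MatOver Q N) (_ : E Q x ≤ 1) (R : ℕ) (z : MatOver R M) (_ : capCap M K R z ≤ 1),
        ENNReal.ofReal ‖weightedKron (edgeWeight (neighbor f)) z x‖ := by
  have hcancel : ENNReal.ofReal K⁻¹ * ENNReal.ofReal K = 1 := by
    rw [← ENNReal.ofReal_mul (inv_nonneg.2 hK.le), inv_mul_cancel₀ hK.ne', ENNReal.ofReal_one]
  have hsum (x : MatOver Q N) {R : ℕ} (z : MatOver R M) :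
      opNorm (∑ v, z v ⊗ₖ amplification (conMap f) x v) =
        ‖weightedKron (edgeWeight (neighbor f)) z x‖ := by
    have hkron (v : Fin M) := map_sum (Matrix.kroneckerBilinear (R := ℝ) (z v))
      (fun u => edgeWeight (neighbor f) v u • x u) Finset.univ
    simp only [map_smul] at hkron
    rw [opNorm, weightedMap_apply]
    simp only [← hkron, amplification_conMap]
    rfl
  simp only [amplifiedNorm, sigmaSigma, opDual, ENNReal.mul_iSup, ← mul_assoc, hcancel, one_mul,
    hsum]

theorem entangledValueDim_le (f : Fin D → Fin N → Fin M) {K K' : ℝ} (hK : 0 ≤ K) (hK' : 0 < K')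
    (hn : (n : ℝ) * K = Fintype.card (Fin N)) (hm : (m : ℝ) * K' = Fintype.card (Fin M)) :
    entangledValueDim (neighbor f) n m Q ≤
      ENNReal.ofReal K'⁻¹ * amplifiedNorm (capCap N K) (sigmaSigma M K') Q (conMap f) := by
  rw [inv_mul_amplifiedNorm hK', entangledValueDim_eq_iSup]
  refine iSup₂_le fun φ hφ => iSup₂_le fun P hP => iSup₂_le fun R hR => ?_
  have hx := hP.isBoundedFamily_marginal hn
  have hz := hR.isBoundedFamily_marginal hm
  refine le_iSup₂_of_le _ (hx.capCap_le_one hK) (le_iSup_of_le Q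
    (le_iSup₂_of_le _ (hz.capCap_le_one hK'.le) (ENNReal.ofReal_le_ofReal ?_)))
  exact vectorForm_le_norm hφ
    (isHermitian_weightedKron (edgeWeight_nonneg _) hz.nonneg hx.nonneg)

theorem weightedKron_le_smul_one (G : Fin N → Fin D → Fin M) {K K' : ℝ}
    (hn : (n : ℝ) * K = Fintype.card (Fin N)) (hm : (m : ℝ) * K' = Fintype.card (Fin M))
    (hω : entangledValueDim G n m Q ≠ ⊤) {R : ℕ} {c : MatOver R M} (hc : IsBoundedFamily K' c)
    {a : MatOver Q N} (ha : IsBoundedFamily K a) :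
    weightedKron (edgeWeight G) c a ≤ (256 * (entangledValueDim G n m Q).toReal) • 1 := by
  have hw := edgeWeight_nonneg G
  refine weightedKron_le_smul_one_of_forall hw ha.nonneg (fun c hc => ?_) hc
  refine le_smul_one_of_forall_unit (isHermitian_weightedKron hw hc.nonneg ha.nonneg)
    fun φ hφ => ?_
  obtain ⟨P, R, hP, hR, hle⟩ := exists_isStrategy_pair hn hm
    (T := (weightedKron (edgeWeight G)).compr₂ (vectorForm φ))
    (fun c a hc ha => vectorForm_nonneg φ (weightedKron_nonneg hw hc ha)) hc ha
  refine hle.trans (mul_le_mul_of_nonneg_left ?_ (by norm_num))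
  rw [LinearMap.compr₂_apply, ← ENNReal.ofReal_le_iff_le_toReal hω, entangledValueDim_eq_iSup]
  exact le_iSup₂_of_le φ hφ (le_iSup₂_of_le P hP (le_iSup₂_of_le R hR le_rfl))

theorem norm_weightedKron_le_of_forall {w : Fin M → Fin N → ℝ} (hw : ∀ v u, 0 ≤ w v u)
    {K K' r : ℝ} (hK : 0 ≤ K) (hK' : 0 ≤ K') (hr : 0 ≤ r) {R : ℕ}
    (h : ∀ (c : MatOver R M) (a : MatOver Q N), IsBoundedFamily K' c → IsBoundedFamily K a →
      weightedKron w c a ≤ r • 1)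
    {z : MatOver R M} (hz : capCap M K' R z ≤ 1) {x : MatOver Q N} (hx : capCap N K Q x ≤ 1) :
    ‖weightedKron w z x‖ ≤ r := by
  have bound {η : ℝ} (hη : 1 < η) : ‖weightedKron w z x‖ ≤ η * (η * r) := by
    have hone : 1 < ENNReal.ofReal η := ENNReal.one_lt_ofReal.2 hη
    obtain ⟨c, d, hc, hd, s, hs, hsη, hzs⟩ := exists_factorization_of_capCap_lt (hz.trans_lt hone)
    obtain ⟨a, b, ha, hb, t, ht, htη, hxt⟩ := exists_factorization_of_capCap_lt (hx.trans_lt hone)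
    have hca := h _ _ (isBoundedFamily_rowBlock_mul_conjTranspose hK' hc)
      (isBoundedFamily_rowBlock_mul_conjTranspose hK ha)
    have hdb := h _ _ (isBoundedFamily_rowBlock_mul_conjTranspose hK' hd)
      (isBoundedFamily_rowBlock_mul_conjTranspose hK hb)
    obtain rfl : z = s • fun v => rowBlock c v * (rowBlock d v)ᴴ := funext hzs
    obtain rfl : x = t • fun u => rowBlock a u * (rowBlock b u)ᴴ := funext hxt
    rw [map_smul, map_smul, LinearMap.smul_apply, norm_smul, norm_smul, Real.norm_of_nonneg hs,
      Real.norm_of_nonneg ht]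
    gcongr
    exact norm_weightedKron_mul_conjTranspose_le hw hr hca hdb
  have hlim : Filter.Tendsto (fun η : ℝ => η * (η * r)) (nhdsWithin 1 (Set.Ioi 1)) (nhds r) :=
    (Continuous.tendsto' (by fun_prop) _ _ (by simp)).mono_left nhdsWithin_le_nhds
  exact ge_of_tendsto hlim (Filter.eventually_of_mem self_mem_nhdsWithin fun η => bound)

theorem inv_mul_amplifiedNorm_le (f : Fin D → Fin N → Fin M) {K K' : ℝ} (hK : 0 ≤ K)
    (hK' : 0 < K') (hn : (n : ℝ) * K = Fintype.card (Fin N))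
    (hm : (m : ℝ) * K' = Fintype.card (Fin M)) :
    ENNReal.ofReal K'⁻¹ * amplifiedNorm (capCap N K) (sigmaSigma M K') Q (conMap f) ≤
      256 * entangledValueDim (neighbor f) n m Q := by
  rw [inv_mul_amplifiedNorm hK']
  by_cases hω : entangledValueDim (neighbor f) n m Q = ⊤
  · rw [hω, ENNReal.mul_top (by norm_num)]
    exact le_top
  refine iSup₂_le fun x hx => iSup_le fun R => iSup₂_le fun z hz => ?_
  rw [ENNReal.ofReal_le_iff_le_toReal (ENNReal.mul_ne_top (by norm_num) hω), ENNReal.toReal_mul,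
    ENNReal.toReal_ofNat]
  exact norm_weightedKron_le_of_forall (edgeWeight_nonneg _) hK hK'.le (by positivity)
    (fun c a hc ha => weightedKron_le_smul_one _ hn hm hω hc ha) hz hx

end EntangledValue

section DeterministicStrategy

variable {ι : Type*} {n : ℕ}

/-- The strategy that answers the question `x` by `a x`, as a family of scalar effects. -/
def detStrategy (a : (Fin n → ι) → Fin n) (α : Fin n) (x : Fin n → ι) : ℂ :=
  if a x = α then 1 else 0

theorem isStrategy_detStrategy (a : (Fin n → ι) → Fin n) : IsStrategy (detStrategy a) where
  nonneg α x := by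
    unfold detStrategy
    split_ifs
    exacts [zero_le_one, le_rfl]
  sum_le_one x := by simp [detStrategy]

theorem IsStrategy.exists_map_marginal_le_detStrategy [Fintype ι] [DecidableEq ι] [NeZero n]
    {P : Fin n → (Fin n → ι) → ℂ} (hP : IsStrategy P) {Φ : (ι → ℂ) →ₗ[ℝ] ℝ} (hΦ : Monotone Φ) :
    ∃ a : (Fin n → ι) → Fin n, Φ (marginal P) ≤ Φ (marginal (detStrategy a)) := by
  let g (u : ι) : ℝ := Φ (Pi.single u 1)
  have hg (u : ι) : 0 ≤ g u := by
    simpa using hΦ (Pi.single_nonneg.2 zero_le_one : (0 : ι → ℂ) ≤ Pi.single u 1)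
  have map_single {R : Fin n → (Fin n → ι) → ℂ} (hR : IsStrategy R) (α : Fin n)
      (x : Fin n → ι) : Φ (Pi.single (x α) (R α x)) = (R α x).re * g (x α) := by
    rw [← smul_eq_mul, ← map_smul, ← Pi.single_smul', Complex.real_smul, mul_one,
      ← Complex.eq_re_of_ofReal_le (r := 0) (by simpa using hR.nonneg α x)]
  choose a ha using fun x : Fin n → ι => Finite.exists_max fun α => g (x α)
  refine ⟨a, ?_⟩
  rw [map_marginal, map_marginal]
  refine Finset.expect_le_expect fun x _ => ?_
  simp only [map_single hP, map_single (isStrategy_detStrategy a)]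
  have hsum : ∑ α, (P α x).re ≤ 1 := by
    simpa using (Complex.le_def.1 (hP.sum_le_one x)).1
  calc ∑ α, (P α x).re * g (x α) ≤ ∑ α, (P α x).re * g (x (a x)) := by
        gcongr with α
        exacts [(Complex.le_def.1 (hP.nonneg α x)).1, ha x α]
    _ = (∑ α, (P α x).re) * g (x (a x)) := (Finset.sum_mul ..).symm
    _ ≤ g (x (a x)) := mul_le_of_le_one_left (hg _) hsum
    _ = ∑ α, (detStrategy a α x).re * g (x α) := by simp [detStrategy, apply_ite Complex.re]

end DeterministicStrategy

section SumNorm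

theorem isBoundedFamily_ofReal_iff {ι : Type*} [Fintype ι] {K : ℝ} {a : ι → ℝ} :
    IsBoundedFamily K (fun u => (a u : ℂ)) ↔
      (∀ u, 0 ≤ a u) ∧ (∀ u, K * a u ≤ 1) ∧ ∑ u, a u ≤ 1 := by
  have hsmul (u : ι) : K • (a u : ℂ) ≤ 1 ↔ K * a u ≤ 1 := by
    rw [Complex.real_smul]
    norm_cast
  have hsum : ∑ u, (a u : ℂ) ≤ 1 ↔ ∑ u, a u ≤ 1 := by norm_cast
  rw [← hsum]
  simp only [← hsmul, ← Complex.zero_le_real]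
  exact ⟨fun h => ⟨h.1, h.2, h.3⟩, fun h => ⟨h.1, h.2.1, h.2.2⟩⟩

theorem capNorm_le_one_iff {N : ℕ} {K : ℝ} (hK : 0 < K) {x : Fin N → ℂ} :
    capNorm K x ≤ 1 ↔ IsBoundedFamily K fun u => (‖x u‖ : ℂ) := by
  rw [isBoundedFamily_ofReal_iff, capNorm, max_le_iff, ← le_div_iff₀' hK,
    pi_norm_le_iff_of_nonneg (by positivity)]
  simp only [norm_nonneg, implies_true, true_and, le_div_iff₀' hK]

theorem IsBoundedFamily.capNorm_le_one {N : ℕ} {K : ℝ} (hK : 0 < K) {a : Fin N → ℂ}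
    (ha : IsBoundedFamily K a) : capNorm K a ≤ 1 := by
  rw [capNorm_le_one_iff hK]
  simpa only [Complex.norm_of_nonneg' (ha.nonneg _)] using ha

theorem exists_add_eq_norm_le {E : Type*} [NormedAddCommGroup E] [NormedSpace ℝ E] (y : E) {t : ℝ}
    (ht : 0 ≤ t) : ∃ y₁ y₂, y₁ + y₂ = y ∧ ‖y₁‖ ≤ t ∧ ‖y₂‖ ≤ max (‖y‖ - t) 0 := by
  rcases le_or_gt ‖y‖ t with h | h
  · exact ⟨y, 0, add_zero y, h, by simp⟩
  · have hy : 0 < ‖y‖ := ht.trans_lt h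
    refine ⟨(t / ‖y‖) • y, (1 - t / ‖y‖) • y, by module, le_of_eq ?_, le_max_of_le_left ?_⟩
    · rw [norm_smul, Real.norm_of_nonneg (by positivity), div_mul_cancel₀ _ hy.ne']
    · rw [norm_smul, Real.norm_of_nonneg (sub_nonneg.2 ((div_le_one hy).2 h.le)), sub_mul,
        one_mul, div_mul_cancel₀ _ hy.ne']

theorem exists_card_lt_le_card_le {ι : Type*} [Fintype ι] [Nonempty ι] (r : ι → ℝ) {K : ℝ}
    (hK : 0 ≤ K) (hKι : K ≤ Fintype.card ι) :
    ∃ v₀, (Finset.card {v | r v₀ < r v} : ℝ) ≤ K ∧ K ≤ Finset.card {v | r v₀ ≤ r v} := by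
  obtain ⟨w, hw⟩ := Finite.exists_max r
  obtain ⟨v₀, hv₀, hmin⟩ := Set.exists_min_image {v | (Finset.card {i | r v < r i} : ℝ) ≤ K} r
    (Set.toFinite _) ⟨w, by simpa [Finset.filter_false_of_mem, (hw _).not_gt] using hK⟩
  refine ⟨v₀, hv₀, ?_⟩
  by_cases hall : ∀ v, r v₀ ≤ r v
  · simpa [hall] using hKι
  push Not at hall
  obtain ⟨v₁, hv₁, hmax⟩ := Set.exists_max_image {v | r v < r v₀} r (Set.toFinite _) hall
  have hlt : K < Finset.card {i | r v₁ < r i} := by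
    by_contra! h
    exact (hmin v₁ h).not_gt hv₁
  refine hlt.le.trans ?_
  gcongr with v _
  intro hv
  by_contra! h
  exact (hmax v h).not_gt hv

/-- The weights are `K⁻¹` above a threshold `r v₀`, `0` below it, and on the level of `v₀` between
these so as to have total mass `1`. -/
theorem exists_weights_mul_sub_eq {ι : Type*} [Fintype ι] [Nonempty ι] (r : ι → ℝ) {K : ℝ}
    (hK : 0 < K) (hKι : K ≤ Fintype.card ι) :
    ∃ v₀, ∃ z : ι → ℝ, (∀ v, 0 ≤ z v) ∧ (∀ v, K * z v ≤ 1) ∧ ∑ v, z v = 1 ∧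
      ∀ v, K * (z v * (r v - r v₀)) = max (r v - r v₀) 0 := by
  obtain ⟨v₀, hlt, hle⟩ := exists_card_lt_le_card_le r hK.le hKι
  obtain ⟨s, t, hs, ht, hst, hconv⟩ := (Convex.mem_Icc (hlt.trans hle)).1 ⟨hlt, hle⟩
  let z (v : ι) : ℝ := s * (if r v₀ < r v then 1 else 0) + t * (if r v₀ ≤ r v then 1 else 0)
  have hz0 (v) : 0 ≤ z v := by positivity
  have hz1 (v) : z v ≤ 1 := by
    rw [← hst]
    dsimp only [z]
    gcongr <;> split_ifs <;> simp [hs, ht]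
  have hsum : ∑ v, z v = K := by
    rw [← hconv, Finset.sum_add_distrib, ← Finset.mul_sum, ← Finset.mul_sum]
    simp
  refine ⟨v₀, fun v => K⁻¹ * z v, fun v => mul_nonneg (by positivity) (hz0 v), fun v => ?_, ?_,
    fun v => ?_⟩
  · simpa [hK.ne'] using hz1 v
  · rw [← Finset.mul_sum, hsum, inv_mul_cancel₀ hK.ne']
  · rw [mul_assoc, mul_inv_cancel_left₀ hK.ne']
    rcases lt_trichotomy (r v) (r v₀) with h | h | h
    · simp [z, h.not_ge, h.not_gt, h.le]
    · simp [h]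
    · simp [z, h, h.le, hst]

variable {M : ℕ} {K : ℝ}

theorem ofReal_sum_norm_mul_norm_le_sigmaNorm (hK : 0 < K) {z : Fin M → ℂ} (hz : capNorm K z ≤ 1)
    (y : Fin M → ℂ) : ENNReal.ofReal (K * ∑ v, ‖z v‖ * ‖y v‖) ≤ sigmaNorm K y := by
  obtain ⟨-, hzK, hz1⟩ := isBoundedFamily_ofReal_iff.1 ((capNorm_le_one_iff hK).1 hz)
  refine le_iInf fun y₁ => le_iInf fun y₂ => le_iInf fun hy => ENNReal.ofReal_le_ofReal ?_
  subst hy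
  calc K * ∑ v, ‖z v‖ * ‖(y₁ + y₂) v‖ ≤ K * ∑ v, ‖z v‖ * (‖y₁‖ + ‖y₂ v‖) := by
        gcongr with v
        exact (norm_add_le _ _).trans (by gcongr; exact norm_le_pi_norm y₁ v)
    _ = K * ‖y₁‖ * ∑ v, ‖z v‖ + ∑ v, K * ‖z v‖ * ‖y₂ v‖ := by
        rw [Finset.mul_sum, Finset.mul_sum, ← Finset.sum_add_distrib]
        exact Finset.sum_congr rfl fun v _ => by ring
    _ ≤ K * ‖y₁‖ * 1 + ∑ v, 1 * ‖y₂ v‖ := by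
        gcongr
        exact hzK _
    _ = K * ‖y₁‖ + ∑ v, ‖y₂ v‖ := by simp only [mul_one, one_mul]

theorem exists_sigmaNorm_le_ofReal_sum (hK : 0 < K) (hKM : K ≤ M) (y : Fin M → ℂ) :
    ∃ z, capNorm K z ≤ 1 ∧ sigmaNorm K y ≤ ENNReal.ofReal (K * ∑ v, ‖z v‖ * ‖y v‖) := by
  have : NeZero M := ⟨by rintro rfl; exact (hK.trans_le hKM).ne' Nat.cast_zero⟩
  obtain ⟨v₀, z, hz0, hzK, hz1, hz⟩ := exists_weights_mul_sub_eq (fun v => ‖y v‖) hK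
    (by rwa [Fintype.card_fin])
  choose y₁ y₂ hy hy₁ hy₂ using fun v => exists_add_eq_norm_le (y v) (norm_nonneg (y v₀))
  have hnorm (v : Fin M) : ‖(z v : ℂ)‖ = z v := Complex.norm_of_nonneg (hz0 v)
  refine ⟨fun v => z v, ?_, iInf₂_le_of_le y₁ y₂ (iInf_le_of_le (funext hy)
    (ENNReal.ofReal_le_ofReal ?_))⟩
  · simp only [capNorm_le_one_iff hK, hnorm]
    exact isBoundedFamily_ofReal_iff.2 ⟨hz0, hzK, hz1.le⟩
  · simp only [hnorm]
    calc K * ‖y₁‖ + ∑ v, ‖y₂ v‖ ≤ K * ‖y v₀‖ + ∑ v, max (‖y v‖ - ‖y v₀‖) 0 := by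
          gcongr with v
          exacts [(pi_norm_le_iff_of_nonneg (norm_nonneg _)).2 hy₁, hy₂ v]
      _ = K * ∑ v, (z v * ‖y v₀‖ + z v * (‖y v‖ - ‖y v₀‖)) := by
          simp only [← hz]
          rw [Finset.sum_add_distrib, ← Finset.sum_mul, hz1, one_mul, mul_add, Finset.mul_sum]
      _ = K * ∑ v, z v * ‖y v‖ := by simp only [← mul_add, add_sub_cancel]

end SumNorm

section ClassicalValue

/-- The bilinear map `(X, Y) ↦ Re X * Re Y`. -/
noncomputable def reForm : ℂ →ₗ[ℝ] ℂ →ₗ[ℝ] ℝ :=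
  (LinearMap.mul ℝ ℝ).compl₁₂ Complex.reLm Complex.reLm

theorem reForm_apply (X Y : ℂ) : reForm X Y = X.re * Y.re := rfl

variable {N M D n m : ℕ}

theorem classicalValue_eq_iSup (G : Fin N → Fin D → Fin M) :
    classicalValue G n m = ⨆ (a : (Fin n → Fin N) → Fin n) (b : (Fin m → Fin M) → Fin m),
      ENNReal.ofReal (weightedMap (edgeWeight G) reForm (marginal (detStrategy b))
        (marginal (detStrategy a))) := by
  simp only [classicalValue, ← expect_edgeIndicator_mul_eq_weightedMap, reForm_apply]
  simp [detStrategy, apply_ite Complex.re]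

theorem weightedMap_reForm_nonneg (G : Fin N → Fin D → Fin M) (z : Fin M → ℂ) (x : Fin N → ℂ)
    (hz : 0 ≤ z) (hx : 0 ≤ x) : 0 ≤ weightedMap (edgeWeight G) reForm z x :=
  weightedMap_nonneg (edgeWeight_nonneg G)
    (fun _ _ hc ha => mul_nonneg (Complex.le_def.1 hc).1 (Complex.le_def.1 ha).1) z x hz hx

theorem weightedMap_reForm (f : Fin D → Fin N → Fin M) (z : Fin M → ℂ) (x : Fin N → ℂ) :
    weightedMap (edgeWeight (neighbor f)) reForm z x = ∑ v, (z v).re * (conMap f x v).re := by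
  simp only [weightedMap_apply, reForm_apply, conMap_apply, Complex.re_sum, Complex.smul_re,
    smul_eq_mul, Finset.mul_sum, mul_left_comm]

theorem weightedMap_reForm_le_sum_norm (f : Fin D → Fin N → Fin M) (z : Fin M → ℂ)
    (x : Fin N → ℂ) :
    weightedMap (edgeWeight (neighbor f)) reForm z x ≤ ∑ v, ‖z v‖ * ‖conMap f x v‖ := by
  rw [weightedMap_reForm]
  refine Finset.sum_le_sum fun v _ => (le_abs_self _).trans ?_
  rw [abs_mul]
  gcongr <;> exact Complex.abs_re_le_norm _

theorem sum_norm_le_weightedMap_reForm (f : Fin D → Fin N → Fin M) (z : Fin M → ℂ)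
    (x : Fin N → ℂ) :
    ∑ v, ‖z v‖ * ‖conMap f x v‖ ≤ weightedMap (edgeWeight (neighbor f)) reForm
      (fun v => (‖z v‖ : ℂ)) fun u => (‖x u‖ : ℂ) := by
  rw [weightedMap_reForm]
  simp only [conMap_apply, Complex.re_sum, Complex.smul_re, Complex.ofReal_re, smul_eq_mul]
  gcongr with v
  refine (norm_sum_le _ _).trans (le_of_eq (Finset.sum_congr rfl fun u _ => ?_))
  rw [norm_smul, Real.norm_of_nonneg (edgeWeight_nonneg _ v u)]

variable {K K' : ℝ}

theorem classicalValue_le (f : Fin D → Fin N → Fin M) (hK : 0 < K) (hK' : 0 < K')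
    (hn : (n : ℝ) * K = Fintype.card (Fin N)) (hm : (m : ℝ) * K' = Fintype.card (Fin M)) :
    classicalValue (neighbor f) n m ≤ ENNReal.ofReal K'⁻¹ * boundedNorm K K' (conMap f) := by
  rw [classicalValue_eq_iSup]
  refine iSup₂_le fun a b => ?_
  set x : Fin N → ℂ := marginal (detStrategy a)
  set z : Fin M → ℂ := marginal (detStrategy b)
  have hx : capNorm K x ≤ 1 :=
    ((isStrategy_detStrategy a).isBoundedFamily_marginal hn).capNorm_le_one hK
  have hz : capNorm K' z ≤ 1 :=
    ((isStrategy_detStrategy b).isBoundedFamily_marginal hm).capNorm_le_one hK'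
  calc ENNReal.ofReal (weightedMap (edgeWeight (neighbor f)) reForm z x)
      ≤ ENNReal.ofReal (K'⁻¹ * (K' * ∑ v, ‖z v‖ * ‖conMap f x v‖)) := by
        rw [inv_mul_cancel_left₀ hK'.ne']
        exact ENNReal.ofReal_le_ofReal (weightedMap_reForm_le_sum_norm f z x)
    _ ≤ ENNReal.ofReal K'⁻¹ * sigmaNorm K' (conMap f x) := by
        rw [ENNReal.ofReal_mul (by positivity)]
        gcongr
        exact ofReal_sum_norm_mul_norm_le_sigmaNorm hK' hz _
    _ ≤ ENNReal.ofReal K'⁻¹ * boundedNorm K K' (conMap f) := by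
        gcongr
        exact le_iSup₂_of_le x hx le_rfl

theorem ofReal_weightedMap_reForm_le (G : Fin N → Fin D → Fin M) [NeZero n] [NeZero m]
    (hn : (n : ℝ) * K = Fintype.card (Fin N)) (hm : (m : ℝ) * K' = Fintype.card (Fin M))
    {z : Fin M → ℂ} (hz : IsBoundedFamily K' z) {x : Fin N → ℂ} (hx : IsBoundedFamily K x) :
    ENNReal.ofReal (weightedMap (edgeWeight G) reForm z x) ≤ 256 * classicalValue G n m := by
  set T := weightedMap (edgeWeight G) reForm
  have hT : ∀ c a, 0 ≤ c → 0 ≤ a → 0 ≤ T c a := weightedMap_reForm_nonneg G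
  obtain ⟨P, R, hP, hR, hle⟩ := exists_isStrategy_pair hn hm hT hz hx
  have mono_right : Monotone (T (marginal R)) :=
    (monotone_iff_map_nonneg _).2 fun a ha => hT _ a (hR.isBoundedFamily_marginal hm).nonneg ha
  obtain ⟨a, ha⟩ := hP.exists_map_marginal_le_detStrategy mono_right
  have mono_left : Monotone (T.flip (marginal (detStrategy a))) :=
    (monotone_iff_map_nonneg _).2 fun c hc =>
      hT c _ hc ((isStrategy_detStrategy a).isBoundedFamily_marginal hn).nonneg
  obtain ⟨b, hb⟩ := hR.exists_map_marginal_le_detStrategy mono_left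
  calc ENNReal.ofReal (T z x)
      ≤ ENNReal.ofReal (256 * T (marginal (detStrategy b)) (marginal (detStrategy a))) :=
        ENNReal.ofReal_le_ofReal (hle.trans (by gcongr; exact ha.trans hb))
    _ = 256 * ENNReal.ofReal (T (marginal (detStrategy b)) (marginal (detStrategy a))) := by
        rw [ENNReal.ofReal_mul (by norm_num), ENNReal.ofReal_ofNat]
    _ ≤ 256 * classicalValue G n m := by
        rw [classicalValue_eq_iSup]
        gcongr
        exact le_iSup₂_of_le a b le_rfl

theorem inv_mul_boundedNorm_le (f : Fin D → Fin N → Fin M) [NeZero n] [NeZero m] (hK : 0 < K)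
    (hK' : 0 < K') (hn : (n : ℝ) * K = Fintype.card (Fin N))
    (hm : (m : ℝ) * K' = Fintype.card (Fin M)) :
    ENNReal.ofReal K'⁻¹ * boundedNorm K K' (conMap f) ≤ 256 * classicalValue (neighbor f) n m := by
  have hK'M : K' ≤ M := by
    rw [Fintype.card_fin] at hm
    rw [← hm]
    exact le_mul_of_one_le_left hK'.le (by exact_mod_cast NeZero.one_le)
  simp only [boundedNorm, ENNReal.mul_iSup]
  refine iSup₂_le fun x hx => ?_
  obtain ⟨z, hz, hzy⟩ := exists_sigmaNorm_le_ofReal_sum hK' hK'M (conMap f x)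
  calc ENNReal.ofReal K'⁻¹ * sigmaNorm K' (conMap f x)
      ≤ ENNReal.ofReal K'⁻¹ * ENNReal.ofReal (K' * ∑ v, ‖z v‖ * ‖conMap f x v‖) := by gcongr
    _ = ENNReal.ofReal (∑ v, ‖z v‖ * ‖conMap f x v‖) := by
        rw [← ENNReal.ofReal_mul (by positivity), inv_mul_cancel_left₀ hK'.ne']
    _ ≤ ENNReal.ofReal (weightedMap (edgeWeight (neighbor f)) reForm (fun v => (‖z v‖ : ℂ))
          fun u => (‖x u‖ : ℂ)) :=
        ENNReal.ofReal_le_ofReal (sum_norm_le_weightedMap_reForm f z x)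
    _ ≤ 256 * classicalValue (neighbor f) n m :=
        ofReal_weightedMap_reForm_le _ hn hm ((capNorm_le_one_iff hK').1 hz)
          ((capNorm_le_one_iff hK).1 hx)

end ClassicalValue

end Condenser

open Condenser in
theorem theorem8 :
    ∃ c : ℝ≥0, 0 < c ∧
      ∀ (N M D : ℕ) (_ : 0 < N) (_ : 0 < M) (_ : 0 < D) (f : Fin D → Fin N → Fin M)
        (k k' : ℝ) (γ γ' : ℕ)
        (_ : (γ : ℝ) = (N : ℝ) / (2 : ℝ) ^ k) (_ : (γ' : ℝ) = (M : ℝ) / (2 : ℝ) ^ k'),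
        (classicalValue (neighbor f) γ γ' ≤
            ENNReal.ofReal ((2 : ℝ) ^ (-k')) *
              boundedNorm ((2 : ℝ) ^ k) ((2 : ℝ) ^ k') (conMap f) ∧
          ENNReal.ofReal ((2 : ℝ) ^ (-k')) *
              boundedNorm ((2 : ℝ) ^ k) ((2 : ℝ) ^ k') (conMap f) ≤
            (c : ℝ≥0∞) * classicalValue (neighbor f) γ γ') ∧
        (entangledValue (neighbor f) γ γ' ≤
            ENNReal.ofReal ((2 : ℝ) ^ (-k')) *
              cbNorm (capCap N ((2 : ℝ) ^ k)) (sigmaSigma M ((2 : ℝ) ^ k')) (conMap f) ∧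
          ENNReal.ofReal ((2 : ℝ) ^ (-k')) *
              cbNorm (capCap N ((2 : ℝ) ^ k)) (sigmaSigma M ((2 : ℝ) ^ k')) (conMap f) ≤
            (c : ℝ≥0∞) * entangledValue (neighbor f) γ γ') ∧
        ∀ Q : ℕ, 0 < Q →
          entangledValueDim (neighbor f) γ γ' Q ≤
              ENNReal.ofReal ((2 : ℝ) ^ (-k')) *
                amplifiedNorm (capCap N ((2 : ℝ) ^ k)) (sigmaSigma M ((2 : ℝ) ^ k')) Q
                  (conMap f) ∧
            ENNReal.ofReal ((2 : ℝ) ^ (-k')) *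
                amplifiedNorm (capCap N ((2 : ℝ) ^ k)) (sigmaSigma M ((2 : ℝ) ^ k')) Q
                  (conMap f) ≤
              (c : ℝ≥0∞) * entangledValueDim (neighbor f) γ γ' Q := by
  refine ⟨256, by norm_num, ?_⟩
  intro N M D hN hM _ f k k' γ γ' hγ hγ'
  have hK : (0 : ℝ) < 2 ^ k := by positivity
  have hK' : (0 : ℝ) < 2 ^ k' := by positivity
  have hn : (γ : ℝ) * 2 ^ k = Fintype.card (Fin N) := by
    rw [hγ, div_mul_cancel₀ _ hK.ne', Fintype.card_fin]
  have hm : (γ' : ℝ) * 2 ^ k' = Fintype.card (Fin M) := by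
    rw [hγ', div_mul_cancel₀ _ hK'.ne', Fintype.card_fin]
  have : NeZero γ := ⟨by rintro rfl; simp [eq_comm, hN.ne'] at hn⟩
  have : NeZero γ' := ⟨by rintro rfl; simp [eq_comm, hM.ne'] at hm⟩
  rw [Real.rpow_neg zero_le_two, ENNReal.coe_ofNat]
  refine ⟨⟨classicalValue_le f hK hK' hn hm, inv_mul_boundedNorm_le f hK hK' hn hm⟩, ?_,
    fun Q _ => ⟨entangledValueDim_le f hK.le hK' hn hm, inv_mul_amplifiedNorm_le f hK.le hK' hn hm⟩⟩
  simp only [entangledValue, cbNorm, ENNReal.mul_iSup]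
  exact ⟨iSup_mono fun Q => entangledValueDim_le f hK.le hK' hn hm,
    iSup_mono fun Q => inv_mul_amplifiedNorm_le f hK.le hK' hn hm⟩
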